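/- Let $k$ be an algebraically closed field (for instance $k=\mathbb{C}$), let $V$ be a finite-dimensional $k$-vector space, $n=\dim V\ge 0$, and let $u:V\to V$ be a nilpotent endomorphism. Let $Y$ be the Young diagram whose row lengths are the sizes of the Jordan blocks of $u$. Fix a Jordan basis $(e_x)_{x\in Y}$ of $u$ indexed by the boxes of $Y$, that is, a basis of $V$ such that $u(e_x)=0$ if $x$ lies in the first column of $Y$, and $u(e_x)=e_{x'}$ otherwise, where $x'$ is the box just to the left of $x$. Let $\mathcal{B}_u$ be the variety of complete flags $(V_0\subset V_1\subset\dots\subset V_n=V)$, $\dim V_i=i$, such that $u(V_i)\subset V_i$ for all $i$; it is a closed subvariety of the variety of complete flags of $V$. A row-standard tableau of shape $Y$ is a numbering $T'$ of the boxes of $Y$ by $1,\dots,n$ whose entries increase from left to right in each row. Its flag $F_{T'}=(V_0,\dots,V_n)\in\mathcal{B}_u$ is defined by $V_i=\langle e_x : x \text{ has number} \le i \text{ in } T'\rangle$. **Lemma.** Let $K$ be an irreducible component of $\mathcal{B}_u$, with its reduced structure. Then $K$ is nonsingular (at all of its points) if and only if, for every row-standard tableau $T'$ of shape $Y$ such that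 $F_{T'}\in K$, the flag $F_{T'}$ is a nonsingular point of $K$. -/

import Mathlib

open Module

noncomputable section

namespace SpringerFiber

/-! ### Complete flags -/

/-- A complete flag `V_0 ⊂ V_1 ⊂ ... ⊂ V_n = V` with `dim V_i = i`, in a vector space of
dimension `n`. -/
@[ext]
structure CompleteFlag (k V : Type*) [Field k] [AddCommGroup V] [Module k V] (n : ℕ) where
  /-- The `i`-th subspace `V_i`. -/
  space : Fin (n + 1) → Submodule k V
  mono : Monotone space
  finrank_space : ∀ i, finrank k (space i) = i
  space_last : space (Fin.last n) = ⊤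

variable {k V : Type*} [Field k] [AddCommGroup V] [Module k V] {n : ℕ}

/-- The flag of a basis `b_0, ..., b_{n-1}`: its `i`-th subspace is spanned by the first `i`
vectors. -/
def flagOfBasis (b : Basis (Fin n) k V) : CompleteFlag k V n where
  space := b.flag
  mono := b.flag_mono
  finrank_space i := by
    have hli : LinearIndependent k fun j : {j : Fin n | j.castSucc < i} => b j :=
      b.linearIndependent.comp _ Subtype.val_injective
    have h := finrank_span_eq_card hli
    have hr : Set.range (fun j : {j : Fin n | j.castSucc < i} => b j)
        = b '' {j | j.castSucc < i} := by
      ext x; simp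
    rw [hr] at h
    rw [Basis.flag, h, Fintype.card_subtype]
    have hi : (i : ℕ) ≤ n := Nat.lt_succ_iff.mp i.2
    have : (Finset.univ.filter fun j : Fin n => j ∈ {j : Fin n | j.castSucc < i})
        = Finset.univ.filter fun j : Fin n => (j : ℕ) < i := by
      ext j; simp [Fin.lt_def]
    rw [this, Fin.card_filter_val_lt, min_eq_right hi]
  space_last := b.flag_last

/-! ### The algebraic variety of complete flags

The variety structure is given by the usual atlas of affine charts.  The chart attached to a basis
`β` of `V` has as coordinates the entries `a l j` (`j < l`) of a lower unitriangular matrix, and it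
sends `a` to the flag of the basis `β_j + ∑_{l > j} a l j • β_l`.  It is a bijection from affine
space onto the open set of the flags transverse to the flag opposite to that of `β`, and every flag
belongs to such an open set. -/

/-- Positions below the diagonal (row, column), which index the coordinates of a chart. -/
abbrev Below (n : ℕ) : Type := {p : Fin n × Fin n // p.2 < p.1}

/-- The lower unitriangular matrix with prescribed entries below the diagonal. -/
def lowerUnitri (a : Below n → k) : Matrix (Fin n) (Fin n) k :=
  Matrix.of fun l j => if h : j < l then a ⟨(l, j), h⟩ else if l = j then 1 else 0

theorem det_lowerUnitri (a : Below n → k) : (lowerUnitri a).det = 1 := by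
  rw [Matrix.det_of_isLowerTriangular]
  · simp [lowerUnitri]
  · intro i j hij
    have hij' : i < j := by simpa using hij
    simp [lowerUnitri, hij'.not_gt, hij'.ne]

/-- The basis `β_j + ∑_{l > j} a l j • β_l`. -/
def chartBasis (β : Basis (Fin n) k V) (a : Below n → k) : Basis (Fin n) k V :=
  β.map (Matrix.toLinearEquiv β (lowerUnitri a) (by rw [det_lowerUnitri]; exact isUnit_one))

/-- The affine chart of the flag variety attached to the basis `β`. -/
def chart (β : Basis (Fin n) k V) (a : Below n → k) : CompleteFlag k V n :=
  flagOfBasis (chartBasis β a)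

/-- The Zariski topology on affine space `k^σ`: the closed sets are the zero loci of ideals of
polynomials (it is induced from the prime spectrum of the polynomial ring). -/
abbrev affineZariski (k σ : Type*) [Field k] : TopologicalSpace (σ → k) :=
  TopologicalSpace.induced
    (MvPolynomial.pointToPoint : (σ → k) → PrimeSpectrum (MvPolynomial σ k)) inferInstance

/-- The Zariski topology on the flag variety, glued from the charts: a set of flags is open
(closed) if and only if its preimage in each affine chart is Zariski open (closed). -/
instance : TopologicalSpace (CompleteFlag k V n) :=
  ⨆ β : Basis (Fin n) k V, TopologicalSpace.coinduced (chart β) (affineZariski k (Below n))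

/-! ### Nonsingular points -/

/-- The Zariski tangent space at `a` of a Zariski closed subset `Z` of affine space: the common
kernel of the differentials at `a` of the polynomials vanishing on `Z`. -/
def affineTangentSpace {σ : Type*} [Fintype σ] (Z : Set (σ → k)) (a : σ → k) :
    Submodule k (σ → k) where
  carrier := {v | ∀ f ∈ MvPolynomial.vanishingIdeal k Z,
    ∑ s, MvPolynomial.eval a (MvPolynomial.pderiv s f) * v s = 0}
  add_mem' {v w} hv hw f hf := by
    simp only [Pi.add_apply, mul_add, Finset.sum_add_distrib, hv f hf, hw f hf, add_zero]
  zero_mem' f _ := by simp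
  smul_mem' c v hv f hf := by
    have h : ∀ s, MvPolynomial.eval a (MvPolynomial.pderiv s f) * (c • v) s
        = c * (MvPolynomial.eval a (MvPolynomial.pderiv s f) * v s) := by
      intro s; simp only [Pi.smul_apply, smul_eq_mul]; ring
    rw [Finset.sum_congr rfl fun s _ => h s, ← Finset.mul_sum, hv f hf, mul_zero]

/-- `F` is a nonsingular point of the irreducible closed subvariety `K` of the flag variety:
the Zariski tangent space of `K` at `F`, computed in an affine chart around `F`, has the same
dimension as `K` (the choice of the chart is irrelevant). -/
def IsNonsingularAt (K : Set (CompleteFlag k V n)) (F : CompleteFlag k V n) : Prop :=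
  F ∈ K ∧ ∃ (β : Basis (Fin n) k V) (a : Below n → k), chart β a = F ∧
    (finrank k (affineTangentSpace (chart β ⁻¹' K) a) : WithBot ℕ∞) = topologicalKrullDim K

/-- A subvariety is nonsingular if all its points are nonsingular. -/
def IsNonsingular (K : Set (CompleteFlag k V n)) : Prop :=
  ∀ F ∈ K, IsNonsingularAt K F

/-! ### The Springer fiber -/

/-- The Springer fiber of `u`: the set of the `u`-stable complete flags. -/
def springerFiber (u : V →ₗ[k] V) (n : ℕ) : Set (CompleteFlag k V n) :=
  {F | ∀ i, (F.space i).map u ≤ F.space i}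

/-- The irreducible components of the Springer fiber (for the topology induced by the Zariski
topology of the flag variety), as sets of flags. -/
def springerComponents (u : V →ₗ[k] V) (n : ℕ) : Set (Set (CompleteFlag k V n)) :=
  (fun C : Set (springerFiber u n) => Subtype.val '' C) '' irreducibleComponents (springerFiber u n)

/-! ### Jordan bases and row-standard tableaux

Boxes of a Young diagram are pairs (row, column), counted from `0`. -/

/-- `e` is a Jordan basis of `u` indexed by the boxes of `Y`: `u` kills the vectors of the first
column, and sends any other vector to the one of the box just on its left.  Then `u` is nilpotent
and the sizes of its Jordan blocks are the lengths of the rows of `Y`. -/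
def IsJordanBasis {Y : YoungDiagram} (u : V →ₗ[k] V) (e : Basis Y.cells k V) : Prop :=
  (∀ (i : ℕ) (h : (i, 0) ∈ Y.cells), u (e ⟨(i, 0), h⟩) = 0) ∧
  ∀ (i j : ℕ) (h : (i, j + 1) ∈ Y.cells) (h' : (i, j) ∈ Y.cells),
    u (e ⟨(i, j + 1), h⟩) = e ⟨(i, j), h'⟩

/-- A row-standard tableau of shape `Y`: a numbering of the boxes which increases from left to
right in each row (the numbers are `0, ..., n - 1` instead of `1, ..., n`). -/
structure RowStandardTableau (Y : YoungDiagram) where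
  /-- The numbering of the boxes. -/
  entry : Y.cells ≃ Fin Y.card
  row_lt : ∀ x y : Y.cells, x.1.1 = y.1.1 → x.1.2 < y.1.2 → entry x < entry y

/-- The flag attached to a row-standard tableau `T` and a basis `e` indexed by the boxes: its `i`-th
subspace is spanned by the `e x` where `x` runs over the boxes with the `i` smallest numbers. -/
def RowStandardTableau.flag {Y : YoungDiagram} (T : RowStandardTableau Y)
    (e : Basis Y.cells k V) : CompleteFlag k V Y.card :=
  flagOfBasis (e.reindex T.entry)

end SpringerFiber

end

/-! Only the passage from the tableau flags to all of `K` needs an argument, and it is a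
degeneration by a one-parameter group. Let `t` multiply each Jordan vector `e_x` by `t ^ w x`, with
distinct weights `w` that increase by one along each row. These automorphisms satisfy `u ∘ g_t = t •
(g_t ∘ u)`, so they preserve the Springer fiber. They also preserve each component `K`: the union of
the translates of `K` is irreducible, contains `K` and stays in the fiber, so it equals `K` by
maximality (`map_torus_mem`).

As `t` tends to `0`, the orbit of `F ∈ K` tends to a flag `F₀` of coordinate subspaces, read off
from a basis adapted to `F` with distinct leading terms (`exists_limit`). The limit is expressed
algebraically: every open set containing `F₀` contains `g_t F` for all but finitely many `t`. As `K`
is closed and there are infinitely many `t`, `F₀ ∈ K`. Being `u`-stable, `F₀` is the flag of a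
row-standard tableau, so it is a nonsingular point by hypothesis.

Nonsingularity then spreads from `F₀` to `F`. A Jacobian minor whose size is the codimension of the
tangent space at `F₀` is nonzero at `F₀`, hence at some translate `g_t F`, where the tangent space
therefore has dimension at most `dim K`. The opposite inequality holds at every point of an
irreducible closed set (`topologicalKrullDim_le_finrank`), so `g_t F` is nonsingular, and so is `F`,
because `g_t` is an automorphism of the flag variety preserving `K`.

That opposite inequality goes through the transcendence degree of the coordinate ring in a chart. It
is the same in all charts that meet the set and drops strictly on proper closed irreducible subsets,
so it bounds the Krull dimension. The Jacobian criterion, proved with Kähler differentials, bounds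
it in turn by the dimension of the tangent space. -/

noncomputable section

namespace SpringerFiber

universe u v

/-! ### Transcendence degree -/

section Trdeg

open Algebra Cardinal
open scoped IntermediateField.algebraAdjoinAdjoin

/-- The transcendence degree drops strictly along a surjection with a nonzero kernel. -/
theorem trdeg_lt_of_surjective {k : Type*} {A B : Type u} [Field k] [CommRing A]
    [IsDomain A] [CommRing B] [IsDomain B] [Algebra k A] [Algebra k B] (f : A →ₐ[k] B)
    (hf : Function.Surjective f) {a : A} (ha : a ≠ 0) (hfa : f a = 0) (fin : trdeg k A < ℵ₀) :
    trdeg k B < trdeg k A := by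
  obtain ⟨ι, x, hx⟩ := exists_isTranscendenceBasis' k B
  choose g hg using hf
  have hfg : f ∘ (g ∘ x) = x := by ext i; simp [hg]
  have hy : AlgebraicIndependent k (g ∘ x) := .of_comp f (by rw [hfg]; exact hx.1)
  by_contra! hle
  rw [← hx.cardinalMk_eq_trdeg] at hle
  have htb := hy.isTranscendenceBasis_of_trdeg_le fin hle
  have := htb.isAlgebraic
  -- The lifted family would be a transcendence basis of `A`, so `a` would divide a nonzero
  -- polynomial `r` in the lifts. Then `f r = 0` is a relation between the `x i`.
  obtain ⟨r, hr0, hr⟩ := (Algebra.IsAlgebraic.isAlgebraic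
    (R := adjoin k (Set.range (g ∘ x))) a).exists_nonzero_dvd (mem_nonZeroDivisors_of_ne_zero ha)
  have hfr : f r = 0 := by
    obtain ⟨c, hc⟩ := hr
    have hc' : (r : A) = a * c := hc
    rw [hc', map_mul, hfa, zero_mul]
  obtain ⟨p, hp⟩ : ∃ p : MvPolynomial ι k, MvPolynomial.aeval (g ∘ x) p = (r : A) := by
    exact (adjoin_range_eq_range_aeval k (g ∘ x)).le r.2
  have h0 : MvPolynomial.aeval x p = 0 := by
    rw [← hfr, ← hp, ← AlgHom.comp_apply, MvPolynomial.comp_aeval]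
    congr 2
    exact hfg.symm
  have hp0 : p = 0 := (injective_iff_map_eq_zero _).1 hx.1 p h0
  apply hr0
  ext
  rw [← hp, hp0, map_zero]; rfl

/-- The chain rule for derivations. -/
theorem derivation_aeval {k σ L M : Type*} [CommRing k] [CommRing L] [Algebra k L]
    [AddCommGroup M] [Module k M] [Module L M] [IsScalarTower k L M] [Fintype σ]
    (D : Derivation k L M) (x : σ → L) (f : MvPolynomial σ k) :
    D (MvPolynomial.aeval x f) =
      ∑ s, MvPolynomial.aeval x (MvPolynomial.pderiv s f) • D (x s) := by
  classical
  induction f using MvPolynomial.induction_on with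
  | C a => simp
  | add p q hp hq => simp [hp, hq, add_smul, Finset.sum_add_distrib]
  | mul_X p i hp =>
    simp only [map_mul, MvPolynomial.aeval_X, Derivation.leibniz, hp, smul_eq_mul,
      MvPolynomial.pderiv_X, map_add, add_smul, Finset.sum_add_distrib, Finset.smul_sum, mul_smul]
    congr 1
    rw [Finset.sum_eq_single i (fun j _ hj => by simp [hj.symm]) (by simp)]
    simp

/-- The Jacobian criterion: if the Jacobian matrix of `r` elements of a prime ideal `P` has an
`r × r` minor outside `P`, then `P` has at least codimension `r`. -/
theorem trdeg_quotient_add_le {k : Type*} {σ : Type*} [Field k] [Fintype σ]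
    (P : Ideal (MvPolynomial σ k)) [P.IsPrime] {r : ℕ} (s : Fin r → σ)
    (f : Fin r → MvPolynomial σ k) (hf : ∀ i, f i ∈ P)
    (hdet : (Matrix.of fun i j => MvPolynomial.pderiv (s j) (f i)).det ∉ P) :
    trdeg k (MvPolynomial σ k ⧸ P) + r ≤ Fintype.card σ := by
  classical
  let A := MvPolynomial σ k ⧸ P
  let L := FractionRing A
  let x : σ → L := fun i => algebraMap A L (Ideal.Quotient.mk P (MvPolynomial.X i))
  have hx : ∀ p, MvPolynomial.aeval x p = algebraMap A L (Ideal.Quotient.mk P p) := by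
    intro p
    have : MvPolynomial.aeval x =
        (IsScalarTower.toAlgHom k A L).comp (Ideal.Quotient.mkₐ k P) := by
      ext i; simp [x]; rfl
    rw [this]; rfl
  have hx0 : ∀ p, MvPolynomial.aeval x p = 0 ↔ p ∈ P := by
    intro p
    rw [hx, FaithfulSMul.algebraMap_eq_zero_iff, Ideal.Quotient.eq_zero_iff_mem]
  have hs : Function.Injective s := by
    intro i j hij
    by_contra hne
    exact hdet (by rw [Matrix.det_zero_of_column_eq hne (by simp [hij])]; exact P.zero_mem)
  -- `S` consists of the coordinates not involved in the minor. The aim is that `L` is algebraic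
  -- over `F = k(S)`, obtained from the vanishing of the differentials of `L` over `F`.
  let S : Set L := x '' (Set.range s)ᶜ
  let F := IntermediateField.adjoin k S
  have hEss : EssFiniteType F L := EssFiniteType.of_comp k F L
  have hD : ∀ y : L, KaehlerDifferential.D F L y = 0 := by
    let D : Derivation k L (Ω[L⁄F]) := (KaehlerDifferential.D F L).restrictScalars k
    have hDS : ∀ i, i ∉ Set.range s → D (x i) = 0 := by
      intro i hi
      have : x i ∈ F := IntermediateField.subset_adjoin k S ⟨i, hi, rfl⟩
      exact (KaehlerDifferential.D F L).map_algebraMap (⟨x i, this⟩ : F)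
    let J : Matrix (Fin r) (Fin r) L :=
      Matrix.of fun i j => MvPolynomial.aeval x (MvPolynomial.pderiv (s j) (f i))
    have hJ : J.det ≠ 0 := by
      have : J = (MvPolynomial.aeval x).mapMatrix
          (Matrix.of fun i j => MvPolynomial.pderiv (s j) (f i)) := rfl
      rw [this, ← AlgHom.map_det]
      exact fun h => hdet ((hx0 _).1 h)
    have hJs : ∀ i, ∑ j, J i j • D (x (s j)) = 0 := by
      intro i
      have h1 := derivation_aeval D x (f i)
      rw [(hx0 _).2 (hf i), map_zero] at h1
      rw [h1, ← Finset.sum_subset (Finset.subset_univ (Finset.univ.image s)),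
        Finset.sum_image fun a _ b _ h => hs h]
      · rfl
      · intro j _ hj
        rw [hDS j (by simpa using hj), smul_zero]
    -- Differentiating `f i = 0` gives a linear system for the remaining differentials, whose matrix
    -- `J` is invertible.
    have hDs : ∀ j, D (x (s j)) = 0 := by
      intro j
      have h2 : ∑ i, J⁻¹ j i • ∑ l, J i l • D (x (s l)) = D (x (s j)) := by
        simp_rw [Finset.smul_sum, smul_smul]
        rw [Finset.sum_comm]
        simp_rw [← Finset.sum_smul, ← Matrix.mul_apply,
          Matrix.nonsing_inv_mul J (isUnit_iff_ne_zero.2 hJ)]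
        simp [Matrix.one_apply]
      rw [← h2]
      simp [hJs]
    have hDx : ∀ i, D (x i) = 0 := by
      intro i
      by_cases hi : i ∈ Set.range s
      · obtain ⟨j, rfl⟩ := hi; exact hDs j
      · exact hDS i hi
    have hDA : ∀ a : A, D (algebraMap A L a) = 0 := by
      intro a
      obtain ⟨p, rfl⟩ := Ideal.Quotient.mk_surjective a
      rw [← hx, derivation_aeval]
      simp [hDx]
    intro y
    obtain ⟨a, b, hb, rfl⟩ := IsFractionRing.div_surjective (A := A) y
    have hb0 : algebraMap A L b ≠ 0 := by
      simpa using nonZeroDivisors.ne_zero hb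
    have h3 : D (algebraMap A L a / algebraMap A L b * algebraMap A L b) = 0 := by
      rw [div_mul_cancel₀ _ hb0, hDA]
    rw [D.leibniz, hDA, smul_zero, zero_add] at h3
    exact (smul_eq_zero.1 h3).resolve_left hb0
  have hfu : FormallyUnramified F L := by
    refine ⟨Submodule.subsingleton_iff L |>.1 (subsingleton_of_bot_eq_top ?_)⟩
    rw [← KaehlerDifferential.span_range_derivation, eq_comm, Submodule.span_eq_bot]
    rintro _ ⟨y, rfl⟩
    exact hD y
  -- Vanishing differentials force an essentially finite type field extension to be separable
  -- algebraic, in every characteristic.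
  have hsep : Algebra.IsSeparable F L := FormallyUnramified.isSeparable F L
  have : Algebra.IsAlgebraic (adjoin k S) F := by
    exact IsLocalization.isAlgebraic _ (nonZeroDivisors (adjoin k S))
  have : Algebra.IsAlgebraic (adjoin k S) L := .trans _ F _
  have hAL : trdeg k A ≤ trdeg k L :=
    trdeg_le_of_injective (IsScalarTower.toAlgHom k A L) (IsFractionRing.injective A L)
  have hS : trdeg k L ≤ #S := Algebra.IsAlgebraic.trdeg_le_cardinalMk k S
  have hcard : S.ncard + r ≤ Fintype.card σ := by
    have h1 : S.ncard ≤ (Set.range s)ᶜ.ncard := Set.ncard_image_le (Set.toFinite _)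
    have h2 := Set.ncard_add_ncard_compl (Set.range s)
    have h3 : (Set.range s).ncard = r := by
      rw [← Set.image_univ, Set.ncard_image_of_injective _ hs, Set.ncard_univ, Nat.card_fin]
    rw [Nat.card_eq_fintype_card] at h2
    omega
  calc trdeg k A + r ≤ #S + r := by gcongr; exact hAL.trans hS
    _ = ((S.ncard + r : ℕ) : Cardinal) := by
      rw [Nat.cast_add, Set.cast_ncard (Set.toFinite _)]
    _ ≤ Fintype.card σ := by exact_mod_cast hcard

end Trdeg

/-! ### Tangent spaces and minors of the Jacobian matrix -/

section Tangent

variable {k σ : Type*} [Field k]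

/-- The Jacobian minor of the polynomials `f` with respect to the variables `s`. -/
def jacobianMinor {r : ℕ} (s : Fin r → σ) (f : Fin r → MvPolynomial σ k) : MvPolynomial σ k :=
  (Matrix.of fun i j => MvPolynomial.pderiv (s j) (f i)).det

theorem eval_jacobianMinor {r : ℕ} (s : Fin r → σ) (f : Fin r → MvPolynomial σ k) (a : σ → k) :
    MvPolynomial.eval a (jacobianMinor s f) =
      (Matrix.of fun i j => MvPolynomial.eval a (MvPolynomial.pderiv (s j) (f i))).det := by
  rw [jacobianMinor, RingHom.map_det]
  rfl

variable [Fintype σ]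

/-- The codimension of a tangent space is the size of a minor of the Jacobian matrix which does not
vanish. -/
theorem exists_jacobianMinor_ne_zero (Z : Set (σ → k)) (a : σ → k) :
    ∃ (r : ℕ) (s : Fin r → σ) (f : Fin r → MvPolynomial σ k),
      (∀ i, f i ∈ MvPolynomial.vanishingIdeal k Z) ∧
      MvPolynomial.eval a (jacobianMinor s f) ≠ 0 ∧
      finrank k (affineTangentSpace Z a) + r = Fintype.card σ := by
  classical
  let grad : MvPolynomial σ k → σ → k :=
    fun f s => MvPolynomial.eval a (MvPolynomial.pderiv s f)
  let G : Set (σ → k) := grad '' (MvPolynomial.vanishingIdeal k Z)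
  obtain ⟨g, hg, hspan, hli⟩ := Submodule.exists_fun_fin_finrank_span_eq k G
  choose f hf hfg using hg
  generalize finrank k (Submodule.span k G) = r at *
  let A : Matrix (Fin r) σ k := Matrix.of g
  have hT : affineTangentSpace Z a = LinearMap.ker A.mulVecLin := by
    ext v
    rw [LinearMap.mem_ker]
    constructor
    · intro hv
      ext i
      have := hv (f i) (hf i)
      simp only [Matrix.mulVecLin_apply, Matrix.mulVec, dotProduct, Pi.zero_apply]
      rw [← this]
      exact Finset.sum_congr rfl fun s _ => by rw [show A i s = g i s from rfl, ← hfg]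
    · intro hv p hp
      have hmem : grad p ∈ Submodule.span k (Set.range g) := by
        rw [hspan]; exact Submodule.subset_span ⟨p, hp, rfl⟩
      change grad p ⬝ᵥ v = 0
      generalize grad p = w at hmem
      induction hmem using Submodule.span_induction with
      | mem x hx => obtain ⟨i, rfl⟩ := hx; exact congrFun hv i
      | zero => simp
      | add x y _ _ hx hy => rw [add_dotProduct, hx, hy, add_zero]
      | smul c x _ hx => rw [smul_dotProduct, hx, smul_zero]
  have hrank : A.rank = r := by
    have : LinearIndependent k A.row := hli
    simpa using this.rank_matrix
  have hcols := A.rank_eq_finrank_span_cols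
  -- The rows of `A` are `r` independent gradients spanning all the others. Since column rank equals
  -- row rank, `r` independent columns cut out an invertible square block.
  obtain ⟨c, hc, -, hcli⟩ := Submodule.exists_fun_fin_finrank_span_eq k (Set.range A.col)
  replace hcols := hcols.symm.trans hrank
  generalize finrank k (Submodule.span k (Set.range A.col)) = m at *
  subst hcols
  choose s hs using hc
  refine ⟨_, s, f, hf, ?_, ?_⟩
  · rw [eval_jacobianMinor, ← isUnit_iff_ne_zero, ← Matrix.isUnit_iff_isUnit_det,
      ← Matrix.linearIndependent_cols_iff_isUnit]
    convert! hcli using 1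
    ext j i
    rw [← hs j]
    change grad (f i) (s j) = g i (s j)
    rw [hfg]
  · have h1 := A.mulVecLin.finrank_range_add_finrank_ker
    have h2 : finrank k (LinearMap.range A.mulVecLin) = _ := hrank
    rw [finrank_fintype_fun_eq_card] at h1
    rw [hT]
    omega

/-- A nonzero minor of the Jacobian matrix bounds the dimension of the tangent space. -/
theorem finrank_affineTangentSpace_add_le {Z : Set (σ → k)} {a : σ → k} {r : ℕ} {s : Fin r → σ}
    {f : Fin r → MvPolynomial σ k} (hf : ∀ i, f i ∈ MvPolynomial.vanishingIdeal k Z)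
    (h : MvPolynomial.eval a (jacobianMinor s f) ≠ 0) :
    finrank k (affineTangentSpace Z a) + r ≤ Fintype.card σ := by
  classical
  let A : Matrix (Fin r) σ k :=
    Matrix.of fun i s => MvPolynomial.eval a (MvPolynomial.pderiv s (f i))
  have hT : affineTangentSpace Z a ≤ LinearMap.ker A.mulVecLin := by
    intro v hv
    rw [LinearMap.mem_ker]
    ext i
    exact hv (f i) (hf i)
  have hrank : A.rank = r := by
    have : LinearIndependent k A.row := by
      rw [eval_jacobianMinor, ← isUnit_iff_ne_zero, ← Matrix.isUnit_iff_isUnit_det,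
        ← Matrix.linearIndependent_rows_iff_isUnit] at h
      exact LinearIndependent.of_comp (LinearMap.funLeft k k s) h
    simpa using this.rank_matrix
  have h1 := A.mulVecLin.finrank_range_add_finrank_ker
  have h2 := Submodule.finrank_mono hT
  have h3 : finrank k (LinearMap.range A.mulVecLin) = r := hrank
  simp only [finrank_fintype_fun_eq_card] at h1
  omega

end Tangent

/-! ### Flags and adapted bases -/

section Flags

variable {k V : Type*} [Field k] [AddCommGroup V] [Module k V] {n : ℕ}

theorem CompleteFlag.ext_of_le [Module.Finite k V] {F G : CompleteFlag k V n}
    (h : ∀ i, F.space i ≤ G.space i) : F = G := by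
  ext1
  funext i
  exact Submodule.eq_of_le_of_finrank_eq (h i) (by rw [F.finrank_space, G.finrank_space])

theorem flagOfBasis_eq_iff (b : Basis (Fin n) k V) (F : CompleteFlag k V n) :
    flagOfBasis b = F ↔ ∀ j, b j ∈ F.space j.succ := by
  have := b.finiteDimensional_of_finite
  constructor
  · rintro rfl j
    exact Submodule.subset_span ⟨j, by simp [Fin.lt_def], rfl⟩
  · intro h
    refine CompleteFlag.ext_of_le fun i => Submodule.span_le.2 ?_
    rintro _ ⟨j, hj, rfl⟩
    exact F.mono (Fin.castSucc_lt_iff_succ_le.1 hj) (h j)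

theorem mem_flagOfBasis_space_iff (b : Basis (Fin n) k V) (i : Fin (n + 1)) (v : V) :
    v ∈ (flagOfBasis b).space i ↔ ∀ j : Fin n, i ≤ j.castSucc → b.repr v j = 0 := by
  constructor
  · intro hv j hj
    refine Submodule.span_induction (p := fun v _ => b.repr v j = 0) ?_ ?_ ?_ ?_ hv
    · rintro _ ⟨l, hl, rfl⟩
      have : l ≠ j := by rintro rfl; exact absurd hl (not_lt.2 hj)
      simp [this]
    · simp
    · intro x y _ _ hx hy; simp [hx, hy]
    · intro c x _ hx; simp [hx]
  · intro h
    rw [← b.sum_repr v]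
    refine Submodule.sum_mem _ fun j _ => ?_
    by_cases hj : i ≤ j.castSucc
    · rw [h j hj, zero_smul]; exact Submodule.zero_mem _
    · exact Submodule.smul_mem _ _ (Submodule.subset_span ⟨j, not_le.1 hj, rfl⟩)

/-- In a nontrivial relation, the vector of largest index with nonzero coefficient would be a
combination of earlier vectors, which all lie in the space that it avoids. -/
theorem CompleteFlag.linearIndependent (F : CompleteFlag k V n) {v : Fin n → V}
    (h1 : ∀ j, v j ∈ F.space j.succ) (h2 : ∀ j, v j ∉ F.space j.castSucc) :
    LinearIndependent k v := by
  classical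
  rw [Fintype.linearIndependent_iff]
  intro g hg
  by_contra! hne
  let s := Finset.univ.filter fun i => g i ≠ 0
  have hs : s.Nonempty := by obtain ⟨i, hi⟩ := hne; exact ⟨i, by simp [s, hi]⟩
  have hm : g (s.max' hs) ≠ 0 := by simpa [s] using s.max'_mem hs
  set m := s.max' hs
  apply h2 m
  rw [← Submodule.smul_mem_iff _ hm]
  rw [← Finset.add_sum_erase _ _ (Finset.mem_univ m)] at hg
  rw [eq_neg_of_add_eq_zero_left hg]
  refine Submodule.neg_mem _ (Submodule.sum_mem _ fun i hi => ?_)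
  by_cases hgi : g i = 0
  · rw [hgi, zero_smul]; exact Submodule.zero_mem _
  · have hlt : i < m := lt_of_le_of_ne (s.le_max' i (by simp [s, hgi])) (Finset.ne_of_mem_erase hi)
    exact Submodule.smul_mem _ _ (F.mono (Fin.succ_le_castSucc_iff.2 hlt) (h1 i))

theorem CompleteFlag.finrank_eq (F : CompleteFlag k V n) : finrank k V = n := by
  rw [← finrank_top k V, ← F.space_last, F.finrank_space]; simp

/-- A family of vectors which jump with a flag is a basis. -/
theorem CompleteFlag.exists_basis [Module.Finite k V] (F : CompleteFlag k V n) {v : Fin n → V}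
    (h1 : ∀ j, v j ∈ F.space j.succ) (h2 : ∀ j, v j ∉ F.space j.castSucc) :
    ∃ b : Basis (Fin n) k V, ∀ j, b j = v j :=
  ⟨basisOfLinearIndependentOfCardEqFinrank' v (F.linearIndependent h1 h2)
    (by rw [F.finrank_eq, Fintype.card_fin]), fun j => by simp⟩

theorem CompleteFlag.exists_mem_notMem [Module.Finite k V] (F : CompleteFlag k V n) (j : Fin n) :
    ∃ v, v ∈ F.space j.succ ∧ v ∉ F.space j.castSucc := by
  by_contra! h
  have := Submodule.finrank_mono (show F.space j.succ ≤ F.space j.castSucc from h)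
  rw [F.finrank_space, F.finrank_space] at this
  simp at this

end Flags

/-! ### Charts -/

section Charts

variable {k V : Type*} [Field k] [AddCommGroup V] [Module k V] {n : ℕ}

theorem chartBasis_apply (β : Basis (Fin n) k V) (a : Below n → k) (j : Fin n) :
    chartBasis β a j = ∑ l, lowerUnitri a l j • β l := by
  simp [chartBasis, Matrix.toLinearEquiv, Matrix.toLin_self]

theorem toMatrix_chartBasis (β : Basis (Fin n) k V) (a : Below n → k) :
    β.toMatrix (chartBasis β a) = lowerUnitri a := by
  ext i j
  rw [Basis.toMatrix_apply, chartBasis_apply]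
  simp [Finsupp.single_apply]

theorem lowerUnitri_of_lt (a : Below n → k) {l j : Fin n} (h : l < j) : lowerUnitri a l j = 0 := by
  simp [lowerUnitri, h.not_gt, h.ne]

theorem lowerUnitri_self (a : Below n → k) (j : Fin n) : lowerUnitri a j j = 1 := by
  simp [lowerUnitri]

theorem lowerUnitri_below (a : Below n → k) (p : Below n) : lowerUnitri a p.1.1 p.1.2 = a p := by
  simp [lowerUnitri, p.2]

theorem exists_chart_eq [Module.Finite k V] (F : CompleteFlag k V n) :
    ∃ (β : Basis (Fin n) k V) (a : Below n → k), chart β a = F := by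
  choose v h1 h2 using F.exists_mem_notMem
  obtain ⟨b, hb⟩ := F.exists_basis h1 h2
  refine ⟨b, 0, (flagOfBasis_eq_iff _ _).2 fun j => ?_⟩
  have : chartBasis b 0 j = b j := by
    rw [chartBasis_apply, Finset.sum_eq_single j]
    · rw [lowerUnitri_self, one_smul]
    · intro l _ hl; simp [lowerUnitri, hl]
    · simp
  rw [this, hb]; exact h1 j

/-- A flag in the chart of `β` is transverse to the flag opposite to that of `β`. -/
theorem eq_zero_of_mem_chart (β : Basis (Fin n) k V) (a : Below n → k) {i : Fin (n + 1)} {v : V}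
    (hv : v ∈ (chart β a).space i) (h : ∀ l : Fin n, l.castSucc < i → β.repr v l = 0) : v = 0 := by
  have hv' := (mem_flagOfBasis_space_iff _ _ _).1 hv
  set d := (chartBasis β a).repr v with hd
  have hrepr : ∀ l, β.repr v l = ∑ s, lowerUnitri a l s * d s := by
    intro l
    rw [← (chartBasis β a).sum_repr v]
    simp only [map_sum, map_smul, Finsupp.coe_finsetSum, Finset.sum_apply, Finsupp.smul_apply,
      smul_eq_mul]
    refine Finset.sum_congr rfl fun s _ => ?_
    rw [mul_comm, ← toMatrix_chartBasis β a, Basis.toMatrix_apply]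
  have hd0 : ∀ l, d l = 0 := by
    -- Forward substitution in a unitriangular system kills the coefficients below `i`; the others
    -- vanish because `v` lies in the `i`-th space.
    intro l
    induction l using WellFoundedLT.induction with
    | ind l ih =>
      by_cases hl : l.castSucc < i
      · have := h l hl
        rw [hrepr, Finset.sum_eq_single l, lowerUnitri_self, one_mul] at this
        · exact this
        · intro s _ hs
          rcases lt_or_gt_of_ne hs with hs | hs
          · rw [ih s hs, mul_zero]
          · rw [lowerUnitri_of_lt a hs, zero_mul]
        · simp
      · exact hv' l (not_lt.1 hl)
  rw [← (chartBasis β a).repr.map_eq_zero_iff]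
  ext l; exact hd0 l

/-- The `j`-th chart vectors for two parameters of the same flag differ by an element of the
`j.succ` space whose coordinates up to `j` vanish; transversality makes it zero. -/
theorem chart_injective (β : Basis (Fin n) k V) : Function.Injective (chart β) := by
  intro a a' h
  have key : ∀ j, chartBasis β a j = chartBasis β a' j := by
    intro j
    rw [← sub_eq_zero]
    refine eq_zero_of_mem_chart β a' (i := j.succ) (Submodule.sub_mem _ ?_ ?_) ?_
    · exact (flagOfBasis_eq_iff _ _).1 h j
    · exact (flagOfBasis_eq_iff _ _).1 rfl j
    · intro l hl
      rw [map_sub, Finsupp.sub_apply, ← Basis.toMatrix_apply, ← Basis.toMatrix_apply,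
        toMatrix_chartBasis, toMatrix_chartBasis, sub_eq_zero]
      rcases (Fin.castSucc_lt_succ_iff.1 hl).lt_or_eq with hl | rfl
      · rw [lowerUnitri_of_lt _ hl, lowerUnitri_of_lt _ hl]
      · rw [lowerUnitri_self, lowerUnitri_self]
  funext p
  rw [← lowerUnitri_below a p, ← lowerUnitri_below a' p, ← toMatrix_chartBasis β a,
    ← toMatrix_chartBasis β a', Basis.toMatrix_apply, Basis.toMatrix_apply, key]

end Charts

/-! ### Lower-upper factorization -/

section Factorization

variable {R S : Type*} [CommRing R] [CommRing S] {n : ℕ}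

theorem sum_eq_sum_Iic {M : Type*} [AddCommMonoid M] {j : Fin n} (g : Fin n → M)
    (h : ∀ s, j < s → g s = 0) : ∑ s, g s = ∑ x : Set.Iic j, g x := by
  rw [← Finset.sum_subset (Finset.subset_univ (Finset.Iic j)) fun s _ hs => h s (by simpa using hs)]
  exact Finset.sum_subtype _ (fun x => by simp) g

/-- The leading square block of a matrix with last index `j`. -/
def leadBlock (M : Matrix (Fin n) (Fin n) R) (j : Fin n) : Matrix (Set.Iic j) (Set.Iic j) R :=
  M.submatrix Subtype.val Subtype.val

/-- The leading principal minor of a matrix with last index `j`. -/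
def leadMinor (M : Matrix (Fin n) (Fin n) R) (j : Fin n) : R := (leadBlock M j).det

/-- The upper triangular matrix whose product with `M` is lower triangular, with the leading minors
of `M` on its diagonal. -/
def reducer (M : Matrix (Fin n) (Fin n) R) : Matrix (Fin n) (Fin n) R :=
  Matrix.of fun s j => if h : s ≤ j then (leadBlock M j).adjugate ⟨s, Set.mem_Iic.2 h⟩
    ⟨j, Set.self_mem_Iic⟩ else 0

theorem reducer_of_lt (M : Matrix (Fin n) (Fin n) R) {s j : Fin n} (h : j < s) :
    reducer M s j = 0 := by
  simp [reducer, h.not_ge]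

/-- Column `j` of `reducer M` is the last column of the adjugate of the `j`-th leading block, so
this is an entry of `B * adj B = det B • 1`. No division occurs, so the identity holds over any
commutative ring. -/
theorem mul_reducer_of_le (M : Matrix (Fin n) (Fin n) R) {l j : Fin n} (h : l ≤ j) :
    (M * reducer M) l j = if l = j then leadMinor M j else 0 := by
  have h1 : (leadBlock M j * (leadBlock M j).adjugate) ⟨l, Set.mem_Iic.2 h⟩ ⟨j, Set.self_mem_Iic⟩ =
      if l = j then leadMinor M j else 0 := by
    rw [Matrix.mul_adjugate, Matrix.smul_apply, Matrix.one_apply, smul_eq_mul, mul_ite, mul_one,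
      mul_zero]
    simp only [Subtype.mk.injEq]
    rfl
  rw [← h1, Matrix.mul_apply, Matrix.mul_apply, sum_eq_sum_Iic (j := j)]
  · refine Finset.sum_congr rfl fun s _ => ?_
    rw [reducer, Matrix.of_apply, dif_pos (show (s : Fin n) ≤ j from s.2)]
    rfl
  · intro s hs
    rw [reducer_of_lt M hs, mul_zero]

theorem leadMinor_map (M : Matrix (Fin n) (Fin n) R) (φ : R →+* S) (j : Fin n) :
    leadMinor (M.map φ) j = φ (leadMinor M j) := by
  rw [leadMinor, leadMinor, RingHom.map_det]; rfl

theorem reducer_map (M : Matrix (Fin n) (Fin n) R) (φ : R →+* S) :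
    reducer (M.map φ) = (reducer M).map φ := by
  ext s j
  simp only [reducer, Matrix.of_apply, Matrix.map_apply]
  split_ifs with h
  · have := congrFun (congrFun (RingHom.map_adjugate φ (leadBlock M j))
      ⟨s, Set.mem_Iic.2 h⟩) ⟨j, Set.self_mem_Iic⟩
    exact this.symm
  · simp

/-- The common denominator of the coordinates, in a chart, of the flag of the columns of `M`. -/
def flagDen (M : Matrix (Fin n) (Fin n) R) : R := ∏ j, leadMinor M j

/-- The numerators of the coordinates, in a chart, of the flag of the columns of `M`. -/
def flagNum (M : Matrix (Fin n) (Fin n) R) (p : Below n) : R :=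
  (M * reducer M) p.1.1 p.1.2 * ∏ j ∈ Finset.univ.erase p.1.2, leadMinor M j

theorem flagDen_map (M : Matrix (Fin n) (Fin n) R) (φ : R →+* S) :
    flagDen (M.map φ) = φ (flagDen M) := by
  simp [flagDen, leadMinor_map]

theorem flagNum_map (M : Matrix (Fin n) (Fin n) R) (φ : R →+* S) (p : Below n) :
    flagNum (M.map φ) p = φ (flagNum M p) := by
  simp only [flagNum, leadMinor_map, reducer_map, map_mul, map_prod, ← Matrix.map_mul]
  rfl

variable {k V : Type*} [Field k] [AddCommGroup V] [Module k V]

/-- Upper triangular column operations do not change the flag of columns. Applying `reducer M` and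
dividing each column by its leading minor makes the matrix lower unitriangular, and its entries are
the chart coordinates. -/
theorem chart_flagNum_div_flagDen (β : Basis (Fin n) k V) (M : Matrix (Fin n) (Fin n) k)
    (F : CompleteFlag k V n) (hM : ∀ j, ∑ l, M l j • β l ∈ F.space j.succ) (h : flagDen M ≠ 0) :
    chart β (fun p => flagNum M p / flagDen M) = F := by
  refine (flagOfBasis_eq_iff _ _).2 fun j => ?_
  have hΔ : ∀ j, leadMinor M j ≠ 0 := fun j => Finset.prod_ne_zero_iff.1 h j (Finset.mem_univ j)
  have hL : ∀ l, lowerUnitri (fun p => flagNum M p / flagDen M) l j =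
      (leadMinor M j)⁻¹ * (M * reducer M) l j := by
    intro l
    rcases lt_trichotomy l j with hl | rfl | hl
    · rw [lowerUnitri_of_lt _ hl, mul_reducer_of_le M hl.le, if_neg hl.ne, mul_zero]
    · rw [lowerUnitri_self, mul_reducer_of_le M le_rfl, if_pos rfl, inv_mul_cancel₀ (hΔ l)]
    · rw [lowerUnitri_below _ ⟨(l, j), hl⟩, flagNum, flagDen,
        ← Finset.mul_prod_erase Finset.univ _ (Finset.mem_univ j)]
      have : ∏ i ∈ Finset.univ.erase j, leadMinor M i ≠ 0 :=
        Finset.prod_ne_zero_iff.2 fun i _ => hΔ i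
      have := hΔ j
      field_simp
  have hsum : chartBasis β (fun p => flagNum M p / flagDen M) j =
      (leadMinor M j)⁻¹ • ∑ s, reducer M s j • ∑ l, M l s • β l := by
    rw [chartBasis_apply]
    simp_rw [hL, mul_smul, ← Finset.smul_sum, Matrix.mul_apply, Finset.sum_smul, Finset.smul_sum,
      smul_smul]
    rw [Finset.sum_comm]
    simp_rw [mul_comm (M _ _)]
  rw [hsum]
  refine Submodule.smul_mem _ _ (Submodule.sum_mem _ fun s _ => ?_)
  rcases lt_or_ge j s with hs | hs
  · rw [reducer_of_lt M hs, zero_smul]; exact Submodule.zero_mem _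
  · exact Submodule.smul_mem _ _ (F.mono (Fin.succ_le_succ_iff.2 hs) (hM s))

/-- A kernel vector of a singular leading block, extended by zero, gives a combination of the first
columns with vanishing leading coordinates. Transversality makes it zero, against the invertibility
of `M`. -/
theorem flagDen_ne_zero (β : Basis (Fin n) k V) (M : Matrix (Fin n) (Fin n) k) (a : Below n → k)
    (hM : ∀ j, ∑ l, M l j • β l ∈ (chart β a).space j.succ) (hdet : M.det ≠ 0) :
    flagDen M ≠ 0 := by
  refine Finset.prod_ne_zero_iff.2 fun j _ hj => ?_
  obtain ⟨c, hc0, hc⟩ := Matrix.exists_mulVec_eq_zero_iff.2 hj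
  let c' : Fin n → k := fun s => if h : s ≤ j then c ⟨s, Set.mem_Iic.2 h⟩ else 0
  have hc' : ∀ s, j < s → c' s = 0 := fun s hs => by simp [c', hs.not_ge]
  have hrepr : ∀ l, β.repr (∑ s, c' s • ∑ l, M l s • β l) l = M.mulVec c' l := by
    intro l
    simp [Matrix.mulVec, dotProduct, Finsupp.single_apply, mul_comm]
  have hv : ∑ s, c' s • ∑ l, M l s • β l = 0 := by
    refine eq_zero_of_mem_chart β a (i := j.succ) (Submodule.sum_mem _ fun s _ => ?_) ?_
    · rcases lt_or_ge j s with hs | hs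
      · rw [hc' s hs, zero_smul]; exact Submodule.zero_mem _
      · exact Submodule.smul_mem _ _ ((chart β a).mono (Fin.succ_le_succ_iff.2 hs) (hM s))
    · intro l hl
      have hl' : l ≤ j := Fin.castSucc_lt_succ_iff.1 hl
      have h0 : (leadBlock M j).mulVec c ⟨l, Set.mem_Iic.2 hl'⟩ = 0 := congrFun hc _
      rw [hrepr, ← h0, Matrix.mulVec, Matrix.mulVec, dotProduct, dotProduct,
        sum_eq_sum_Iic (j := j)]
      · refine Finset.sum_congr rfl fun s _ => ?_
        simp only [c']
        rw [dif_pos (show (s : Fin n) ≤ j from s.2)]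
        rfl
      · intro s hs
        rw [hc' s hs, mul_zero]
  have hMc : M.mulVec c' = 0 := by
    ext l
    rw [← hrepr, hv]
    simp
  have := Matrix.eq_zero_of_mulVec_eq_zero hdet hMc
  apply hc0
  ext ⟨s, hs⟩
  have := congrFun this s
  simpa [c', show s ≤ j from hs] using this

end Factorization

/-! ### Transition between families of flags and charts -/

section Transition

variable {k : Type u} [Field k] {n : ℕ}

/-- Clearing the denominators in the value of a polynomial at a point `p / q`. -/
theorem exists_homogenization {σ : Type*} {R : Type*} [CommRing R] [Algebra k R] (q : R) (p : σ → R)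
    (f : MvPolynomial σ k) :
    ∃ (h : R) (N : ℕ), ∀ (L : Type v) [Field L] [Algebra k L] (ε : R →ₐ[k] L), ε q ≠ 0 →
      ε h = ε q ^ N * MvPolynomial.aeval (fun s => ε (p s) / ε q) f := by
  -- The numerator `h` and the exponent `N` do not depend on `L` or `ε`: the same `h` can be
  -- evaluated at points of `k` and in a function field.
  induction f using MvPolynomial.induction_on with
  | C c => exact ⟨algebraMap k R c, 0, fun L _ _ ε _ => by simp⟩
  | add f g hf hg =>
    obtain ⟨h₁, N₁, H₁⟩ := hf
    obtain ⟨h₂, N₂, H₂⟩ := hg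
    refine ⟨h₁ * q ^ N₂ + h₂ * q ^ N₁, N₁ + N₂, fun L _ _ ε hq => ?_⟩
    rw [map_add, map_mul, map_mul, map_pow, map_pow, H₁ L ε hq, H₂ L ε hq, map_add]
    ring
  | mul_X f s hf =>
    obtain ⟨h, N, H⟩ := hf
    refine ⟨h * p s, N + 1, fun L _ _ ε hq => ?_⟩
    rw [map_mul, H L ε hq, map_mul, MvPolynomial.aeval_X]
    field_simp
    ring

variable {V : Type*} [AddCommGroup V] [Module k V]

/-- The flag `F` is the flag of the columns of the invertible matrix `M`, in the basis `β`. -/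
def IsColumnFlag (β : Basis (Fin n) k V) (M : Matrix (Fin n) (Fin n) k)
    (F : CompleteFlag k V n) : Prop :=
  M.det ≠ 0 ∧ ∀ j, ∑ l, M l j • β l ∈ F.space j.succ

theorem IsColumnFlag.exists_chart_iff {β : Basis (Fin n) k V} {M : Matrix (Fin n) (Fin n) k}
    {F : CompleteFlag k V n} (h : IsColumnFlag β M F) : (∃ a, chart β a = F) ↔ flagDen M ≠ 0 := by
  refine ⟨?_, fun hM => ⟨_, chart_flagNum_div_flagDen β M F h.2 hM⟩⟩
  rintro ⟨a, rfl⟩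
  exact flagDen_ne_zero β M a h.2 h.1

theorem isColumnFlag_chart (β β' : Basis (Fin n) k V) (a : Below n → k) :
    IsColumnFlag β (β.toMatrix β' * lowerUnitri a) (chart β' a) := by
  constructor
  · rw [Matrix.det_mul, det_lowerUnitri, mul_one, ← isUnit_iff_ne_zero,
      ← Matrix.isUnit_iff_isUnit_det]
    have := β.invertibleToMatrix β'
    exact isUnit_of_invertible _
  · intro j
    have : ∑ l, (β.toMatrix β' * lowerUnitri a) l j • β l = chartBasis β' a j := by
      rw [← toMatrix_chartBasis β' a, Basis.toMatrix_mul_toMatrix]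
      exact β.sum_toMatrix_smul_self _ _
    rw [this]
    exact (flagOfBasis_eq_iff _ _).1 rfl j

/-- The condition that a flag of columns belongs to a basic open set of a chart is polynomial. -/
theorem exists_forall_mem_chart_iff {R : Type*} [CommRing R] [Algebra k R]
    (β : Basis (Fin n) k V) (M : Matrix (Fin n) (Fin n) R) (f : MvPolynomial (Below n) k) :
    ∃ g : R, ∀ (ε : R →ₐ[k] k) (F : CompleteFlag k V n), IsColumnFlag β (M.map ε) F →
      (F ∈ chart β '' {a | MvPolynomial.eval a f ≠ 0} ↔ ε g ≠ 0) := by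
  obtain ⟨h, N, H⟩ := exists_homogenization.{u, u} (flagDen M) (flagNum M) f
  -- The factor `flagDen M` detects membership in the chart, and `h` detects the nonvanishing of `f`
  -- there.
  refine ⟨flagDen M * h, fun ε F hF => ?_⟩
  have hden : flagDen (M.map ε) = ε (flagDen M) := flagDen_map M (ε : R →+* k)
  have hnum : flagNum (M.map ε) = fun p => ε (flagNum M p) := by
    funext p; exact flagNum_map M (ε : R →+* k) p
  have hmem := hF.exists_chart_iff
  by_cases hq : ε (flagDen M) = 0
  · rw [map_mul, hq, zero_mul]
    rw [hden, hq] at hmem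
    simp only [ne_eq, not_true_eq_false, iff_false]
    rintro ⟨a, -, ha⟩
    exact hmem.1 ⟨a, ha⟩ rfl
  · have hchart := chart_flagNum_div_flagDen β _ F hF.2 (by rwa [hden])
    rw [hden, hnum] at hchart
    rw [map_mul, H k ε hq, mul_ne_zero_iff, mul_ne_zero_iff, ← hchart,
      (chart_injective β).mem_set_image, Set.mem_ofPred_eq]
    simp only [hq, ne_eq, not_false_eq_true, pow_ne_zero, true_and]
    rfl

/-- The generic lower unitriangular matrix. -/
def genericLowerUnitri (k : Type*) [Field k] (n : ℕ) :
    Matrix (Fin n) (Fin n) (MvPolynomial (Below n) k) :=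
  Matrix.of fun l j => if h : j < l then MvPolynomial.X ⟨(l, j), h⟩ else if l = j then 1 else 0

theorem genericLowerUnitri_map (a : Below n → k) :
    (genericLowerUnitri k n).map (MvPolynomial.aeval a) = lowerUnitri a := by
  ext l j
  simp only [genericLowerUnitri, lowerUnitri, Matrix.map_apply, Matrix.of_apply]
  split_ifs <;> simp

/-- The change of charts, as a matrix over the ring of coordinates of the chart of `β'`. -/
def transition (β β' : Basis (Fin n) k V) : Matrix (Fin n) (Fin n) (MvPolynomial (Below n) k) :=
  (β.toMatrix β').map MvPolynomial.C * genericLowerUnitri k n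

theorem transition_map (β β' : Basis (Fin n) k V) (a : Below n → k) :
    (transition β β').map (MvPolynomial.aeval a) = β.toMatrix β' * lowerUnitri a := by
  rw [transition, Matrix.map_mul, genericLowerUnitri_map, Matrix.map_map]
  congr 1
  ext i j
  simp

theorem isColumnFlag_transition (β β' : Basis (Fin n) k V) (a : Below n → k) :
    IsColumnFlag β ((transition β β').map (MvPolynomial.aeval a)) (chart β' a) := by
  rw [transition_map]; exact isColumnFlag_chart β β' a

end Transition

/-! ### The Zariski topology of the flag variety -/

section Topology

variable {k : Type u} [Field k] {n : ℕ}

theorem isOpen_affineZariski_iff {σ : Type*} {U : Set (σ → k)} :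
    @IsOpen _ (affineZariski k σ) U ↔ ∀ a ∈ U, ∃ f : MvPolynomial σ k,
      MvPolynomial.eval a f ≠ 0 ∧ ∀ b, MvPolynomial.eval b f ≠ 0 → b ∈ U := by
  have hmem : ∀ (f : MvPolynomial σ k) (a : σ → k),
      MvPolynomial.pointToPoint a ∈ PrimeSpectrum.basicOpen f ↔ MvPolynomial.eval a f ≠ 0 := by
    intro f a
    rw [PrimeSpectrum.mem_basicOpen]
    change f ∉ MvPolynomial.vanishingIdeal k {a} ↔ _
    rw [MvPolynomial.mem_vanishingIdeal_singleton_iff]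
    rfl
  let := affineZariski k σ
  rw [((PrimeSpectrum.isTopologicalBasis_basic_opens).induced
    (MvPolynomial.pointToPoint (k := k))).isOpen_iff]
  refine forall₂_congr fun a _ => ⟨?_, ?_⟩
  · rintro ⟨_, ⟨_, ⟨f, rfl⟩, rfl⟩, ha, hU⟩
    exact ⟨f, (hmem f a).1 ha, fun b hb => hU ((hmem f b).2 hb)⟩
  · rintro ⟨f, hf, hU⟩
    exact ⟨_, ⟨_, ⟨f, rfl⟩, rfl⟩, (hmem f a).2 hf, fun b hb => hU b ((hmem f b).1 hb)⟩

variable {V : Type*} [AddCommGroup V] [Module k V]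

theorem isOpen_iff {U : Set (CompleteFlag k V n)} :
    IsOpen U ↔ ∀ (β : Basis (Fin n) k V) (a : Below n → k), chart β a ∈ U →
      ∃ f : MvPolynomial (Below n) k, MvPolynomial.eval a f ≠ 0 ∧
        ∀ b, MvPolynomial.eval b f ≠ 0 → chart β b ∈ U := by
  rw [isOpen_iSup_iff]
  exact forall_congr' fun β => isOpen_coinduced.trans isOpen_affineZariski_iff

/-- The basic open sets of the charts are open. -/
theorem isOpen_chart_image (β : Basis (Fin n) k V) (f : MvPolynomial (Below n) k) :
    IsOpen (chart β '' {a | MvPolynomial.eval a f ≠ 0}) := by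
  rw [isOpen_iff]
  intro β' a ha
  obtain ⟨g, hg⟩ := exists_forall_mem_chart_iff β (transition β β') f
  have h := fun b => hg (MvPolynomial.aeval b) _ (isColumnFlag_transition β β' b)
  exact ⟨g, (h a).1 ha, fun b hb => (h b).2 hb⟩

theorem isOpen_range_chart (β : Basis (Fin n) k V) : IsOpen (Set.range (chart β)) := by
  simpa using isOpen_chart_image β (1 : MvPolynomial (Below n) k)

theorem exists_mem_vanishingIdeal {Z : Set (CompleteFlag k V n)} (hZ : IsClosed Z)
    {β : Basis (Fin n) k V} {a : Below n → k} (ha : chart β a ∉ Z) :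
    ∃ f ∈ MvPolynomial.vanishingIdeal k (chart β ⁻¹' Z), MvPolynomial.eval a f ≠ 0 := by
  obtain ⟨f, hf, hU⟩ := isOpen_iff.1 hZ.isOpen_compl β a ha
  refine ⟨f, fun b hb => ?_, hf⟩
  by_contra h
  exact hU b h hb

/-- An open set which contains a point of an algebraic curve of flags contains all but finitely many
of them. -/
theorem finite_setOf_notMem [Module.Finite k V] {U : Set (CompleteFlag k V n)} (hU : IsOpen U)
    (e : Basis (Fin n) k V) (M : Matrix (Fin n) (Fin n) (Polynomial k))
    (φ : k → CompleteFlag k V n) {t₀ : k}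
    (h₀ : IsColumnFlag e (M.map (Polynomial.aeval t₀)) (φ t₀)) (hmem : φ t₀ ∈ U) :
    {t | IsColumnFlag e (M.map (Polynomial.aeval t)) (φ t) ∧ φ t ∉ U}.Finite := by
  obtain ⟨β, a, hβ⟩ := exists_chart_eq (φ t₀)
  rw [← hβ] at hmem
  obtain ⟨f, hf, hfU⟩ := isOpen_iff.1 hU β a hmem
  have hcol : ∀ t F, IsColumnFlag e (M.map (Polynomial.aeval t)) F →
      IsColumnFlag β ((((β.toMatrix e).map Polynomial.C) * M).map (Polynomial.aeval t)) F := by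
    intro t F h
    have hmap : (((β.toMatrix e).map Polynomial.C) * M).map (Polynomial.aeval t) =
        β.toMatrix e * M.map (Polynomial.aeval t) := by
      rw [Matrix.map_mul, Matrix.map_map]
      congr 1
      ext i j
      simp
    rw [hmap]
    constructor
    · rw [Matrix.det_mul, mul_ne_zero_iff]
      refine ⟨?_, h.1⟩
      rw [← isUnit_iff_ne_zero, ← Matrix.isUnit_iff_isUnit_det]
      have := β.invertibleToMatrix e
      exact isUnit_of_invertible _
    · intro j
      convert! h.2 j using 1
      simp_rw [Matrix.mul_apply, Finset.sum_smul]
      rw [Finset.sum_comm]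
      refine Finset.sum_congr rfl fun s _ => ?_
      rw [← β.sum_toMatrix_smul_self e s, Finset.smul_sum]
      refine Finset.sum_congr rfl fun l _ => ?_
      rw [smul_smul, mul_comm]
  -- Here `g` is a polynomial in one variable, nonzero at `t₀`; the exceptional parameters are among
  -- its finitely many roots.
  obtain ⟨g, hg⟩ := exists_forall_mem_chart_iff β (((β.toMatrix e).map Polynomial.C) * M) f
  have hg₀ : Polynomial.aeval t₀ g ≠ 0 :=
    (hg (Polynomial.aeval t₀) _ (hcol t₀ _ h₀)).1 ⟨a, hf, hβ⟩
  have hg0 : g ≠ 0 := by rintro rfl; simp at hg₀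
  refine (g.rootSet_finite k).subset ?_
  rintro t ⟨ht, htU⟩
  rw [Polynomial.mem_rootSet]
  refine ⟨hg0, ?_⟩
  by_contra h
  obtain ⟨b, hb, hbt⟩ := (hg (Polynomial.aeval t) _ (hcol t _ ht)).2 h
  exact htU (hbt ▸ hfU b hb)

/-- The Springer fiber is closed. -/
theorem isClosed_springerFiber (u : V →ₗ[k] V) : IsClosed (springerFiber u n) := by
  rw [← isOpen_compl_iff, isOpen_iff]
  intro β a ha
  -- This is the matrix of `u` in the generic chart basis. Since the determinant is one, the
  -- adjugate is the inverse and the entries are polynomials; `u`-stability says that those below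
  -- the diagonal vanish.
  let D : Matrix (Fin n) (Fin n) (MvPolynomial (Below n) k) :=
    (genericLowerUnitri k n).adjugate * (LinearMap.toMatrix β β u).map MvPolynomial.C *
      genericLowerUnitri k n
  have hD : ∀ b l j, MvPolynomial.eval b (D l j) =
      (chartBasis β b).repr (u (chartBasis β b j)) l := by
    intro b l j
    have h1 : D.map (MvPolynomial.aeval b) =
        (lowerUnitri b).adjugate * LinearMap.toMatrix β β u * lowerUnitri b := by
      rw [Matrix.map_mul, Matrix.map_mul, genericLowerUnitri_map, Matrix.map_map]
      congr 2
      · rw [← genericLowerUnitri_map b]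
        exact RingHom.map_adjugate
          (MvPolynomial.aeval b : MvPolynomial (Below n) k →ₐ[k] k).toRingHom _
      · ext i j
        simp
    have h2 : (lowerUnitri b).adjugate = (chartBasis β b).toMatrix β := by
      have h3 : (chartBasis β b).toMatrix β * lowerUnitri b = 1 := by
        rw [← toMatrix_chartBasis β b, Basis.toMatrix_mul_toMatrix_flip]
      have h4 := (lowerUnitri b).mul_adjugate
      rw [det_lowerUnitri, one_smul] at h4
      rw [← Matrix.one_mul (lowerUnitri b).adjugate, ← h3, Matrix.mul_assoc, h4, Matrix.mul_one]
    rw [h2, ← toMatrix_chartBasis β b, basis_toMatrix_mul_linearMap_toMatrix_mul_basis_toMatrix]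
      at h1
    have h5 := congrFun (congrFun h1 l) j
    rw [LinearMap.toMatrix_apply] at h5
    exact h5
  have hX : ∀ b, chart β b ∈ springerFiber u n ↔
      ∀ j l, j < l → MvPolynomial.eval b (D l j) = 0 := by
    intro b
    simp_rw [hD]
    constructor
    · intro h j l hjl
      have h1 : u (chartBasis β b j) ∈ (chart β b).space j.succ :=
        h j.succ (Submodule.mem_map_of_mem ((flagOfBasis_eq_iff _ _).1 rfl j))
      exact (mem_flagOfBasis_space_iff _ _ _).1 h1 l (Fin.succ_le_castSucc_iff.2 hjl)
    · intro h i
      change Submodule.map u (Submodule.span k _) ≤ _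
      rw [Submodule.map_span_le]
      rintro _ ⟨j, hj, rfl⟩
      refine (mem_flagOfBasis_space_iff _ _ _).2 fun l hl => h j l ?_
      exact Fin.castSucc_lt_castSucc_iff.1 (lt_of_lt_of_le hj hl)
  rw [Set.mem_compl_iff, hX] at ha
  push Not at ha
  obtain ⟨j, l, hjl, hne⟩ := ha
  exact ⟨D l j, hne, fun b hb hb' => hb ((hX b).1 hb' j l hjl)⟩

end Topology

/-! ### The dimension of subvarieties of the flag variety -/

section Dimension

open Algebra Cardinal

theorem trdeg_fractionRing (k : Type u) (A : Type v) [Field k] [CommRing A] [IsDomain A]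
    [Algebra k A] : trdeg k (FractionRing A) = trdeg k A := by
  have : Algebra.IsAlgebraic A (FractionRing A) := IsLocalization.isAlgebraic _ (nonZeroDivisors A)
  rw [← trdeg_add_eq k A (A := FractionRing A), trdeg_eq_zero (R := A), add_zero]

variable {k : Type u} {V : Type v} [Field k] [AddCommGroup V] [Module k V] {n : ℕ}

/-- The ideal of a set of flags in a chart. -/
def chartIdeal (β : Basis (Fin n) k V) (Z : Set (CompleteFlag k V n)) :
    Ideal (MvPolynomial (Below n) k) :=
  MvPolynomial.vanishingIdeal k (chart β ⁻¹' Z)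

theorem mem_chartIdeal {β : Basis (Fin n) k V} {Z : Set (CompleteFlag k V n)}
    {f : MvPolynomial (Below n) k} :
    f ∈ chartIdeal β Z ↔ ∀ a, chart β a ∈ Z → MvPolynomial.eval a f = 0 := Iff.rfl

/-- If neither `f` nor `g` vanishes on `Z`, their nonvanishing loci are open sets meeting `Z`, hence
meet each other in `Z`, where `f * g` is then nonzero. -/
theorem isPrime_chartIdeal {β : Basis (Fin n) k V} {Z : Set (CompleteFlag k V n)}
    (hZ : IsIrreducible Z) (hne : (chart β ⁻¹' Z).Nonempty) : (chartIdeal β Z).IsPrime := by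
  refine ⟨fun h => ?_, fun {f g} hfg => ?_⟩
  · obtain ⟨a, ha⟩ := hne
    have h1 : (1 : MvPolynomial (Below n) k) ∈ chartIdeal β Z := h ▸ Submodule.mem_top
    simpa using mem_chartIdeal.1 h1 a ha
  · by_contra! h
    obtain ⟨hf, hg⟩ := h
    simp only [mem_chartIdeal, not_forall] at hf hg
    obtain ⟨a, ha, hfa⟩ := hf
    obtain ⟨b, hb, hgb⟩ := hg
    obtain ⟨_, hc, ⟨c, hfc, rfl⟩, d, hgd, hcd⟩ := hZ.2 _ _ (isOpen_chart_image β f)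
      (isOpen_chart_image β g) ⟨_, ha, a, hfa, rfl⟩ ⟨_, hb, b, hgb, rfl⟩
    rw [chart_injective β hcd] at hgd
    have := mem_chartIdeal.1 hfg c hc
    rw [map_mul] at this
    exact (mul_ne_zero hfc hgd) this

/-- The coordinate rings in two charts have the same transcendence degree. -/
theorem trdeg_chartIdeal_le {β β' : Basis (Fin n) k V} {Z : Set (CompleteFlag k V n)}
    (hZ : IsIrreducible Z) (hne : (chart β ⁻¹' Z).Nonempty) (hne' : (chart β' ⁻¹' Z).Nonempty) :
    trdeg k (MvPolynomial (Below n) k ⧸ chartIdeal β' Z) ≤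
      trdeg k (MvPolynomial (Below n) k ⧸ chartIdeal β Z) := by
  have := isPrime_chartIdeal hZ hne
  let A := MvPolynomial (Below n) k ⧸ chartIdeal β Z
  let L := FractionRing A
  let ε : MvPolynomial (Below n) k →ₐ[k] L :=
    (IsScalarTower.toAlgHom k A L).comp (Ideal.Quotient.mkₐ k (chartIdeal β Z))
  have hε : ∀ f, ε f = 0 ↔ f ∈ chartIdeal β Z := by
    intro f
    rw [← Ideal.Quotient.eq_zero_iff_mem]
    exact FaithfulSMul.algebraMap_eq_zero_iff A L
  let M := transition β' β
  have hM := fun a => isColumnFlag_transition β' β a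
  have hden : ∀ a : Below n → k, flagDen (M.map (MvPolynomial.aeval a)) =
      MvPolynomial.eval a (flagDen M) :=
    fun a => flagDen_map M (MvPolynomial.aeval a : MvPolynomial (Below n) k →ₐ[k] k).toRingHom
  have hnum : ∀ a : Below n → k, flagNum (M.map (MvPolynomial.aeval a)) =
      fun p => MvPolynomial.eval a (flagNum M p) :=
    fun a => funext fun p =>
      flagNum_map M (MvPolynomial.aeval a : MvPolynomial (Below n) k →ₐ[k] k).toRingHom p
  have hchart : ∀ a, MvPolynomial.eval a (flagDen M) ≠ 0 →
      chart β' (fun p => MvPolynomial.eval a (flagNum M p) / MvPolynomial.eval a (flagDen M)) =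
        chart β a := by
    intro a ha
    have := chart_flagNum_div_flagDen β' _ _ (hM a).2 (by rwa [hden])
    rwa [hden, hnum] at this
  have hq : ε (flagDen M) ≠ 0 := by
    rw [Ne, hε]
    intro h
    obtain ⟨a, ha⟩ := hne
    obtain ⟨b, hb⟩ := hne'
    obtain ⟨_, hc, ⟨c, rfl⟩, d, hd⟩ := hZ.2 _ _ (isOpen_range_chart β) (isOpen_range_chart β')
      ⟨_, ha, a, rfl⟩ ⟨_, hb, b, rfl⟩
    have h1 := (hM c).exists_chart_iff.1 ⟨d, hd⟩
    rw [hden] at h1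
    exact h1 (mem_chartIdeal.1 h c hc)
  -- Pullback of the coordinates of `β'` by the rational change of charts. Its kernel is `chartIdeal
  -- β' Z`, so the coordinate ring in `β'` embeds in the function field `L`.
  let θ : MvPolynomial (Below n) k →ₐ[k] L :=
    MvPolynomial.aeval fun p => ε (flagNum M p) / ε (flagDen M)
  have hθ : ∀ f, θ f = 0 ↔ f ∈ chartIdeal β' Z := by
    intro f
    obtain ⟨h, N, H⟩ := exists_homogenization.{u, u} (flagDen M) (flagNum M) f
    have hθh : θ f = 0 ↔ h ∈ chartIdeal β Z := by
      rw [← hε, H L ε hq, mul_eq_zero, or_iff_right (pow_ne_zero _ hq)]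
    rw [hθh]
    have Hk := fun a => H k (MvPolynomial.aeval a)
    constructor
    · intro hh
      by_contra hf
      simp only [mem_chartIdeal, not_forall] at hf
      obtain ⟨b, hb, hfb⟩ := hf
      obtain ⟨a, ha⟩ := hne
      obtain ⟨_, hc, ⟨c, rfl⟩, d, hfd, hcd⟩ := hZ.2 _ _ (isOpen_range_chart β)
        (isOpen_chart_image β' f) ⟨_, ha, a, rfl⟩ ⟨_, hb, b, hfb, rfl⟩
      have hqc := (hM c).exists_chart_iff.1 ⟨d, hcd⟩
      rw [hden] at hqc
      have h1 := Hk c hqc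
      have h2 : MvPolynomial.eval c h = 0 := mem_chartIdeal.1 hh c hc
      have h3 := chart_injective β' ((hchart c hqc).trans hcd.symm)
      have h4 : (fun s => MvPolynomial.aeval c (flagNum M s) / MvPolynomial.aeval c (flagDen M)) =
        d := h3
      rw [h4] at h1
      exact mul_ne_zero (pow_ne_zero N hqc) hfd (h1.symm.trans h2)
    · intro hf
      -- The value of `h` is controlled only on the overlap of the charts. Multiplying by `flagDen
      -- M` ensures vanishing elsewhere, and primality then removes this factor.
      have hmul : flagDen M * h ∈ chartIdeal β Z := by
        rw [mem_chartIdeal]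
        intro a ha
        rw [map_mul]
        by_cases hqa : MvPolynomial.eval a (flagDen M) = 0
        · rw [hqa, zero_mul]
        · have h1 := Hk a hqa
          have h2 := mem_chartIdeal.1 hf _ ((hchart a hqa).symm ▸ ha)
          have h3 : MvPolynomial.eval a h = 0 := h1.trans (mul_eq_zero_of_right _ h2)
          rw [h3, mul_zero]
      exact (this.mem_or_mem hmul).resolve_left fun h => hq ((hε _).2 h)
  have hinj : Function.Injective (Ideal.Quotient.liftₐ (chartIdeal β' Z) θ
      fun f hf => (hθ f).2 hf) := by
    rw [injective_iff_map_eq_zero]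
    intro y hy
    obtain ⟨f, rfl⟩ := Ideal.Quotient.mk_surjective y
    exact Ideal.Quotient.eq_zero_iff_mem.2 ((hθ f).1 hy)
  exact (trdeg_le_of_injective _ hinj).trans (trdeg_fractionRing k A).le

/-- By irreducibility of `Z'`, the complement of `Z` meets `Z'` inside the chart, so some polynomial
vanishes on `Z` but not on `Z'`, and restriction of functions has a nonzero kernel. -/
theorem trdeg_chartIdeal_lt {β : Basis (Fin n) k V} {Z Z' : Set (CompleteFlag k V n)}
    (hZ : IsIrreducible Z) (hcl : IsClosed Z) (hZ' : IsIrreducible Z') (hlt : Z ⊂ Z')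
    (hne : (chart β ⁻¹' Z).Nonempty) :
    trdeg k (MvPolynomial (Below n) k ⧸ chartIdeal β Z) <
      trdeg k (MvPolynomial (Below n) k ⧸ chartIdeal β Z') := by
  have hne' : (chart β ⁻¹' Z').Nonempty := hne.mono fun a ha => hlt.1 ha
  have := isPrime_chartIdeal hZ hne
  have := isPrime_chartIdeal hZ' hne'
  have hle : chartIdeal β Z' ≤ chartIdeal β Z := fun f hf a ha => hf a (hlt.1 ha)
  obtain ⟨F, hF, hFZ⟩ := Set.exists_of_ssubset hlt
  obtain ⟨a, ha⟩ := hne'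
  obtain ⟨_, hb, ⟨b, rfl⟩, hbZ⟩ := hZ'.2 _ _ (isOpen_range_chart β) hcl.isOpen_compl
    ⟨_, ha, a, rfl⟩ ⟨F, hF, hFZ⟩
  obtain ⟨f, hf, hfb⟩ := exists_mem_vanishingIdeal hcl hbZ
  refine trdeg_lt_of_surjective (Ideal.Quotient.factorₐ k hle) (Ideal.Quotient.factor_surjective hle)
    (a := Ideal.Quotient.mk _ f) ?_ ?_ (trdeg_lt_aleph0_of_finiteType)
  · rw [Ne, Ideal.Quotient.eq_zero_iff_mem]
    exact fun h => hfb (h b hb)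
  · exact Ideal.Quotient.eq_zero_iff_mem.2 hf

theorem trdeg_chartIdeal_lt_aleph0 (β : Basis (Fin n) k V) (Z : Set (CompleteFlag k V n)) :
    trdeg k (MvPolynomial (Below n) k ⧸ chartIdeal β Z) < ℵ₀ :=
  trdeg_lt_aleph0_of_finiteType

/-- The dimension of an irreducible subvariety is at most the transcendence degree of its coordinate
ring in any chart. -/
theorem topologicalKrullDim_le_trdeg [Module.Finite k V] {K : Set (CompleteFlag k V n)}
    (hK : IsIrreducible K) (hcl : IsClosed K) {β : Basis (Fin n) k V}
    (hne : (chart β ⁻¹' K).Nonempty) :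
    topologicalKrullDim K ≤
      (toNat (trdeg k (MvPolynomial (Below n) k ⧸ chartIdeal β K)) : ℕ) := by
  let S : TopologicalSpace.IrreducibleCloseds K → Set (CompleteFlag k V n) :=
    fun Z => Subtype.val '' (Z : Set K)
  have hS : ∀ Z, IsIrreducible (S Z) := fun Z =>
    Z.isIrreducible.image _ continuous_subtype_val.continuousOn
  have hScl : ∀ Z, IsClosed (S Z) := fun Z =>
    hcl.isClosedEmbedding_subtypeVal.isClosedMap _ Z.isClosed
  have hSK : ∀ Z, S Z ⊆ K := fun Z => Subtype.coe_image_subset _ _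
  have hmono : ∀ Z Z', Z < Z' → S Z ⊂ S Z' := fun Z Z' h =>
    Subtype.val_injective.image_strictMono h
  have hex : ∀ Z, ∃ γ : Basis (Fin n) k V, (chart γ ⁻¹' S Z).Nonempty := by
    intro Z
    obtain ⟨F, hF⟩ := (hS Z).1
    obtain ⟨γ, a, rfl⟩ := exists_chart_eq F
    exact ⟨γ, a, hF⟩
  choose γ hγ using hex
  -- A strictly increasing bounded function to `ℕ` bounds the length of chains. The chart varies
  -- with `Z`, which may miss the chart of `β`.
  let d : TopologicalSpace.IrreducibleCloseds K → ℕ :=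
    fun Z => toNat (trdeg k (MvPolynomial (Below n) k ⧸ chartIdeal (γ Z) (S Z)))
  have hd : StrictMono d := by
    intro Z Z' h
    have hne' : (chart (γ Z) ⁻¹' S Z').Nonempty := (hγ Z).mono fun a ha => (hmono _ _ h).1 ha
    refine toNat_lt_toNat ?_ (trdeg_chartIdeal_lt_aleph0 _ _)
    exact (trdeg_chartIdeal_lt (hS Z) (hScl Z) (hS Z') (hmono _ _ h) (hγ Z)).trans_le
      (trdeg_chartIdeal_le (hS Z') (hγ Z') hne')
  have hdK : ∀ Z, d Z ≤ toNat (trdeg k (MvPolynomial (Below n) k ⧸ chartIdeal β K)) := by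
    intro Z
    have hne' : (chart (γ Z) ⁻¹' K).Nonempty := (hγ Z).mono fun a ha => hSK Z ha
    refine toNat_le_toNat ?_ (trdeg_chartIdeal_lt_aleph0 _ _)
    refine le_trans ?_ (trdeg_chartIdeal_le hK hne hne')
    rcases (hSK Z).eq_or_ssubset with h | h
    · rw [h]
    · exact (trdeg_chartIdeal_lt (hS Z) (hScl Z) hK h (hγ Z)).le
  refine iSup_le fun p => ?_
  have h1 := LTSeries.head_add_length_le_nat (p.map d hd)
  have h2 := hdK p.last
  have h3 : p.length ≤ toNat (trdeg k (MvPolynomial (Below n) k ⧸ chartIdeal β K)) := by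
    rw [LTSeries.last_map] at h1
    simp only [LTSeries.map_length] at h1
    omega
  exact_mod_cast h3

/-- The tangent spaces of an irreducible subvariety have at least its dimension. -/
theorem topologicalKrullDim_le_finrank [Module.Finite k V] {K : Set (CompleteFlag k V n)}
    (hK : IsIrreducible K) (hcl : IsClosed K) {β : Basis (Fin n) k V} {a : Below n → k}
    (ha : chart β a ∈ K) :
    topologicalKrullDim K ≤ finrank k (affineTangentSpace (chart β ⁻¹' K) a) := by
  have hne : (chart β ⁻¹' K).Nonempty := ⟨a, ha⟩
  refine (topologicalKrullDim_le_trdeg hK hcl hne).trans ?_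
  obtain ⟨r, s, f, hf, hdet, hr⟩ := exists_jacobianMinor_ne_zero (chart β ⁻¹' K) a
  have := isPrime_chartIdeal hK hne
  have h1 := trdeg_quotient_add_le (chartIdeal β K) s f hf fun h => hdet (h a ha)
  have h2 := toNat_le_toNat h1 natCast_lt_aleph0
  rw [toNat_add (trdeg_chartIdeal_lt_aleph0 _ _) natCast_lt_aleph0, toNat_natCast,
    toNat_natCast] at h2
  have h3 : toNat (trdeg k (MvPolynomial (Below n) k ⧸ chartIdeal β K)) ≤
      finrank k (affineTangentSpace (chart β ⁻¹' K) a) := by omega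
  exact_mod_cast h3

end Dimension

/-! ### The action of linear automorphisms on flags -/

section Action

variable {k V : Type*} [Field k] [AddCommGroup V] [Module k V] {n : ℕ}

/-- The image of a flag by a linear automorphism. -/
def CompleteFlag.map (F : CompleteFlag k V n) (g : V ≃ₗ[k] V) : CompleteFlag k V n where
  space i := (F.space i).map (g : V →ₗ[k] V)
  mono _ _ h := Submodule.map_mono (F.mono h)
  finrank_space i := by rw [LinearEquiv.finrank_map_eq, F.finrank_space]
  space_last := by rw [F.space_last, Submodule.map_top, LinearEquiv.range]

theorem CompleteFlag.map_map (F : CompleteFlag k V n) (g h : V ≃ₗ[k] V) :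
    (F.map g).map h = F.map (g.trans h) := by
  ext1
  funext i
  exact (Submodule.map_comp _ _ _).symm

theorem CompleteFlag.map_refl (F : CompleteFlag k V n) : F.map (LinearEquiv.refl k V) = F := by
  ext1
  funext i
  exact Submodule.map_id _

theorem CompleteFlag.mem_map {F : CompleteFlag k V n} {g : V ≃ₗ[k] V} {i : Fin (n + 1)} {v : V}
    (h : v ∈ F.space i) : g v ∈ (F.map g).space i :=
  Submodule.mem_map_of_mem h

theorem chart_map (β : Basis (Fin n) k V) (a : Below n → k) (g : V ≃ₗ[k] V) :
    chart (β.map g) a = (chart β a).map g := by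
  refine (flagOfBasis_eq_iff _ _).2 fun j => ?_
  have : chartBasis (β.map g) a j = g (chartBasis β a j) := by
    rw [chartBasis_apply, chartBasis_apply, map_sum]
    simp
  rw [this]
  exact CompleteFlag.mem_map ((flagOfBasis_eq_iff _ _).1 rfl j)

/-- Transporting the chart by `g⁻¹` leaves the preimage of `K` in affine space unchanged, so the
tangent space is literally the same and no differential has to be computed. -/
theorem IsNonsingularAt.of_map {K : Set (CompleteFlag k V n)} {F : CompleteFlag k V n}
    {g : V ≃ₗ[k] V} (hK : ∀ G : CompleteFlag k V n, G.map g ∈ K ↔ G ∈ K)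
    (h : IsNonsingularAt K (F.map g)) : IsNonsingularAt K F := by
  obtain ⟨hF, β, a, ha, hdim⟩ := h
  have key : ∀ b, (chart (β.map g.symm) b).map g = chart β b := by
    intro b
    rw [chart_map, CompleteFlag.map_map, LinearEquiv.symm_trans_self, CompleteFlag.map_refl]
  refine ⟨(hK F).1 hF, β.map g.symm, a, ?_, ?_⟩
  · rw [chart_map, ha, CompleteFlag.map_map, LinearEquiv.self_trans_symm, CompleteFlag.map_refl]
  · rw [← hdim]
    have : chart (β.map g.symm) ⁻¹' K = chart β ⁻¹' K := by
      ext b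
      rw [Set.mem_preimage, Set.mem_preimage, ← hK, key]
    rw [this]

theorem isOpen_preimage_map {U : Set (CompleteFlag k V n)} (hU : IsOpen U) (g : V ≃ₗ[k] V) :
    IsOpen {F : CompleteFlag k V n | F.map g ∈ U} := by
  rw [isOpen_iff]
  intro β a ha
  simp only [Set.mem_ofPred_eq, ← chart_map] at ha ⊢
  exact isOpen_iff.1 hU (β.map g) a ha

end Action

/-! ### One-parameter subgroups -/

section Torus

variable {k V : Type*} [Field k] [AddCommGroup V] [Module k V] {n : ℕ} {ι : Type*}

/-- The automorphism which multiplies each vector of a basis by a power of `t`. -/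
def torus (e : Basis ι k V) (w : ι → ℕ) (t : kˣ) : V ≃ₗ[k] V :=
  e.equiv (e.unitsSMul fun x => t ^ w x) (Equiv.refl ι)

theorem torus_basis (e : Basis ι k V) (w : ι → ℕ) (t : kˣ) (x : ι) :
    torus e w t (e x) = (t : k) ^ w x • e x := by
  rw [torus, Basis.equiv_apply, Equiv.refl_apply, Basis.unitsSMul_apply, Units.smul_def,
    Units.val_pow_eq_pow_val]

theorem torus_trans (e : Basis ι k V) (w : ι → ℕ) (s t : kˣ) :
    (torus e w s).trans (torus e w t) = torus e w (s * t) := by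
  refine e.ext' fun x => ?_
  rw [LinearEquiv.trans_apply, torus_basis, map_smul, torus_basis, torus_basis, smul_smul,
    Units.val_mul, mul_pow]

theorem torus_one (e : Basis ι k V) (w : ι → ℕ) : torus e w 1 = LinearEquiv.refl k V :=
  e.ext' fun x => by simp [torus_basis]

theorem repr_torus (e : Basis ι k V) (w : ι → ℕ) (t : kˣ) (v : V) (x : ι) :
    e.repr (torus e w t v) x = (t : k) ^ w x * e.repr v x := by
  have : (Finsupp.lapply x ∘ₗ (e.repr : V →ₗ[k] ι →₀ k)) ∘ₗ (torus e w t : V →ₗ[k] V) =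
      (t : k) ^ w x • (Finsupp.lapply x ∘ₗ (e.repr : V →ₗ[k] ι →₀ k)) := by
    refine e.ext fun y => ?_
    by_cases h : y = x
    · subst h; simp [torus_basis]
    · simp [torus_basis, h]
  exact LinearMap.congr_fun this v

theorem isColumnFlag_toMatrix (e b : Basis (Fin n) k V) {F : CompleteFlag k V n}
    (h : ∀ j, b j ∈ F.space j.succ) : IsColumnFlag e (e.toMatrix b) F := by
  constructor
  · rw [← isUnit_iff_ne_zero, ← Matrix.isUnit_iff_isUnit_det]
    have := e.invertibleToMatrix b
    exact isUnit_of_invertible _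
  · intro j
    rw [e.sum_toMatrix_smul_self]
    exact h j

open scoped Classical in
/-- The orbit of a flag under a one-parameter subgroup, completed at the origin. -/
def orbitCurve (e : Basis (Fin n) k V) (w : Fin n → ℕ) (F F₀ : CompleteFlag k V n) (t : k) :
    CompleteFlag k V n :=
  if h : t = 0 then F₀ else F.map (torus e w (Units.mk0 t h))

theorem orbitCurve_zero (e : Basis (Fin n) k V) (w : Fin n → ℕ) (F F₀ : CompleteFlag k V n) :
    orbitCurve e w F F₀ 0 = F₀ := dif_pos rfl

theorem orbitCurve_units (e : Basis (Fin n) k V) (w : Fin n → ℕ) (F F₀ : CompleteFlag k V n)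
    (t : kˣ) : orbitCurve e w F F₀ t = F.map (torus e w t) := by
  rw [orbitCurve, dif_neg t.ne_zero]
  simp

theorem exists_adapted_basis [Module.Finite k V] (F : CompleteFlag k V n) :
    ∃ b : Basis (Fin n) k V, ∀ j, b j ∈ F.space j.succ := by
  choose v h1 h2 using F.exists_mem_notMem
  obtain ⟨b, hb⟩ := F.exists_basis h1 h2
  exact ⟨b, fun j => hb j ▸ h1 j⟩

/-- An open set which meets the orbit of a flag under a one-parameter subgroup contains all but
finitely many points of the orbit. -/
theorem finite_setOf_orbit_notMem {U : Set (CompleteFlag k V n)} (hU : IsOpen U)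
    (e : Basis (Fin n) k V) (w : Fin n → ℕ) (F : CompleteFlag k V n) {s : kˣ}
    (hs : F.map (torus e w s) ∈ U) : {t : kˣ | F.map (torus e w t) ∉ U}.Finite := by
  have := e.finiteDimensional_of_finite
  obtain ⟨b, hb⟩ := exists_adapted_basis F
  let M : Matrix (Fin n) (Fin n) (Polynomial k) :=
    Matrix.of fun l j => Polynomial.C (e.repr (b j) l) * Polynomial.X ^ w l
  have hM : ∀ t : kˣ, IsColumnFlag e (M.map (Polynomial.aeval (t : k)))
      (orbitCurve e w F F t) := by
    intro t
    have h1 : M.map (Polynomial.aeval (t : k)) = e.toMatrix (b.map (torus e w t)) := by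
      ext l j
      simp only [M, Matrix.map_apply, Matrix.of_apply, map_mul, Polynomial.aeval_C, map_pow,
        Polynomial.aeval_X, Basis.toMatrix_apply, Basis.map_apply, repr_torus,
        Algebra.algebraMap_self, RingHom.id_apply]
      exact mul_comm _ _
    rw [h1, orbitCurve_units]
    exact isColumnFlag_toMatrix _ _ fun j => CompleteFlag.mem_map (hb j)
  have hfin := finite_setOf_notMem hU e M (orbitCurve e w F F) (hM s)
    (by rwa [orbitCurve_units])
  refine (hfin.preimage Units.val_injective.injOn).subset fun t ht => ⟨hM t, ?_⟩
  rwa [orbitCurve_units]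

/-- A basis adapted to a flag whose vectors have distinct leading terms, for the order given by the
weights `w`. -/
theorem exists_basis_leading [Module.Finite k V] (e : Basis (Fin n) k V) {w : Fin n → ℕ}
    (hw : Function.Injective w) (F : CompleteFlag k V n) :
    ∃ (b : Basis (Fin n) k V) (x : Equiv.Perm (Fin n)), (∀ j, b j ∈ F.space j.succ) ∧
      (∀ j, e.repr (b j) (x j) = 1) ∧ ∀ j l, w l < w (x j) → e.repr (b j) l = 0 := by
  have hlead : ∀ v : V, v ≠ 0 → ∃ x, e.repr v x ≠ 0 ∧ ∀ l, w l < w x → e.repr v l = 0 := by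
    intro v hv
    have hne : (e.repr v).support.Nonempty := by simpa using hv
    obtain ⟨x, hx, hmin⟩ := (e.repr v).support.exists_min_image w hne
    refine ⟨x, by simpa using hx, fun l hl => ?_⟩
    by_contra h
    exact absurd (hmin l (by simpa using h)) (not_le.2 hl)
  -- Among the vectors new at step `j`, choose one whose leading term has the largest possible
  -- weight. The last clause records this maximality.
  have hex : ∀ j : Fin n, ∃ (v : V) (x : Fin n), v ∈ F.space j.succ ∧ v ∉ F.space j.castSucc ∧
      e.repr v x = 1 ∧ (∀ l, w l < w x → e.repr v l = 0) ∧
      ∀ v' ∈ F.space j.succ, v' ∉ F.space j.castSucc → ∃ l, w l ≤ w x ∧ e.repr v' l ≠ 0 := by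
    intro j
    let S : Set (Fin n) := {x | ∃ v, v ∈ F.space j.succ ∧ v ∉ F.space j.castSucc ∧
      e.repr v x ≠ 0 ∧ ∀ l, w l < w x → e.repr v l = 0}
    have hS : ∀ v ∈ F.space j.succ, v ∉ F.space j.castSucc → ∃ x ∈ S, e.repr v x ≠ 0 := by
      intro v h1 h2
      obtain ⟨x, hx1, hx2⟩ := hlead v (by rintro rfl; exact h2 (Submodule.zero_mem _))
      exact ⟨x, ⟨v, h1, h2, hx1, hx2⟩, hx1⟩
    obtain ⟨v₀, h1, h2⟩ := F.exists_mem_notMem j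
    obtain ⟨x₀, hx₀, -⟩ := hS v₀ h1 h2
    obtain ⟨x, ⟨v, hv1, hv2, hvx, hvl⟩, hmax⟩ := S.exists_max_image w (Set.toFinite _) ⟨x₀, hx₀⟩
    refine ⟨(e.repr v x)⁻¹ • v, x, Submodule.smul_mem _ _ hv1, ?_, ?_, ?_, ?_⟩
    · rwa [Submodule.smul_mem_iff _ (inv_ne_zero hvx)]
    · simp [hvx]
    · intro l hl; simp [hvl l hl]
    · intro v' h1' h2'
      obtain ⟨l, hl, hne⟩ := hS v' h1' h2'
      exact ⟨l, hmax l hl, hne⟩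
  choose v x h1 h2 h3 h4 h5 using hex
  have hlt : ∀ i j, i < j → x i ≠ x j := by
    intro i j hij heq
    have hi : v i ∈ F.space j.castSucc := F.mono (Fin.succ_le_castSucc_iff.2 hij) (h1 i)
    -- With equal leading positions, the normalized leading terms cancel: `v j - v i` is still new
    -- at step `j` but leads at a larger weight, against maximality.
    obtain ⟨l, hl, hne⟩ := h5 j (v j - v i)
      (Submodule.sub_mem _ (h1 j) (F.mono (Fin.castSucc_le_succ j) hi))
      (fun h => h2 j (by simpa using Submodule.add_mem _ h hi))
    apply hne
    rw [map_sub, Finsupp.sub_apply]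
    rcases hl.lt_or_eq with hl | hl
    · rw [h4 j l hl, h4 i l (heq ▸ hl), sub_zero]
    · obtain rfl := hw hl
      rw [h3 j, ← heq, h3 i, sub_self]
  have hinj : Function.Injective x := by
    intro i j h
    rcases lt_trichotomy i j with hij | hij | hij
    · exact absurd h (hlt i j hij)
    · exact hij
    · exact absurd h.symm (hlt j i hij)
  obtain ⟨b, hb⟩ := F.exists_basis h1 h2
  refine ⟨b, Equiv.ofBijective x (Finite.injective_iff_bijective.1 hinj), fun j => ?_, fun j => ?_,
    fun j l hl => ?_⟩
  · rw [hb]; exact h1 j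
  · rw [hb]; exact h3 j
  · rw [hb]; exact h4 j l hl

/-- The orbit of a flag under a one-parameter subgroup with distinct weights converges to a flag of
coordinate subspaces. -/
theorem exists_limit (e : Basis (Fin n) k V) {w : Fin n → ℕ} (hw : Function.Injective w)
    (F : CompleteFlag k V n) : ∃ x : Equiv.Perm (Fin n), ∀ U, IsOpen U →
      flagOfBasis (e.reindex x) ∈ U → {t : kˣ | F.map (torus e w t) ∉ U}.Finite := by
  have := e.finiteDimensional_of_finite
  obtain ⟨b, x, hb, hx1, hx0⟩ := exists_basis_leading e hw F
  refine ⟨x.symm, fun U hU hmem => ?_⟩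
  set F₀ := flagOfBasis (e.reindex x.symm) with hF₀
  -- Column `j` is the image of `b j` under the torus, divided by `t ^ w (x j)`; at `t = 0` only the
  -- leading vector `e (x j)` survives. The subtraction truncates only where the coefficient is
  -- zero.
  let M : Matrix (Fin n) (Fin n) (Polynomial k) :=
    Matrix.of fun l j => Polynomial.C (e.repr (b j) l) * Polynomial.X ^ (w l - w (x j))
  have hM0 : IsColumnFlag e (M.map (Polynomial.aeval 0)) (orbitCurve e w F F₀ 0) := by
    have h1 : M.map (Polynomial.aeval 0) = e.toMatrix (e.reindex x.symm) := by
      ext l j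
      simp only [M, Matrix.map_apply, Matrix.of_apply, map_mul, Polynomial.aeval_C, map_pow,
        Polynomial.aeval_X, Basis.toMatrix_apply, Basis.reindex_apply, Equiv.symm_symm,
        Basis.repr_self, Algebra.algebraMap_self, RingHom.id_apply]
      rcases lt_trichotomy (w l) (w (x j)) with h | h | h
      · have hne : x j ≠ l := by rintro rfl; exact lt_irrefl _ h
        rw [hx0 j l h, zero_mul, Finsupp.single_eq_of_ne' hne]
      · obtain rfl := hw h
        simp [hx1]
      · have hne : x j ≠ l := by rintro rfl; exact lt_irrefl _ h
        rw [zero_pow (Nat.sub_pos_of_lt h).ne', mul_zero, Finsupp.single_eq_of_ne' hne]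
    rw [h1, orbitCurve_zero]
    exact isColumnFlag_toMatrix _ _ fun j => (flagOfBasis_eq_iff _ _).1 rfl j
  have hM : ∀ t : kˣ, IsColumnFlag e (M.map (Polynomial.aeval (t : k)))
      (orbitCurve e w F F₀ t) := by
    intro t
    have h1 : M.map (Polynomial.aeval (t : k)) =
        e.toMatrix ((b.map (torus e w t)).unitsSMul fun j => (t ^ w (x j))⁻¹) := by
      ext l j
      simp only [M, Matrix.map_apply, Matrix.of_apply, map_mul, Polynomial.aeval_C, map_pow,
        Polynomial.aeval_X, Basis.toMatrix_apply, Basis.unitsSMul_apply, Basis.map_apply,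
        Units.smul_def, map_smul, Finsupp.smul_apply, repr_torus, smul_eq_mul,
        Algebra.algebraMap_self, RingHom.id_apply]
      rcases lt_or_ge (w l) (w (x j)) with h | h
      · rw [hx0 j l h]; simp
      · rw [pow_sub₀ _ t.ne_zero h]
        simp only [Units.val_inv_eq_inv_val, Units.val_pow_eq_pow_val]
        ring
    rw [h1, orbitCurve_units]
    refine isColumnFlag_toMatrix _ _ fun j => ?_
    rw [Basis.unitsSMul_apply, Units.smul_def]
    exact Submodule.smul_mem _ _ (CompleteFlag.mem_map (hb j))
  have hfin := finite_setOf_notMem hU e M (orbitCurve e w F F₀) hM0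
    (by rwa [orbitCurve_zero])
  refine (hfin.preimage Units.val_injective.injOn).subset fun t ht => ⟨hM t, ?_⟩
  rwa [orbitCurve_units]

end Torus

/-! ### Components of the Springer fiber -/

section Components

variable {k V : Type*} [Field k] [AddCommGroup V] [Module k V] {n : ℕ} {u : V →ₗ[k] V}
  {K : Set (CompleteFlag k V n)}

theorem isIrreducible_of_mem_springerComponents (hK : K ∈ springerComponents u n) :
    IsIrreducible K := by
  obtain ⟨C, hC, rfl⟩ := hK
  exact hC.1.image _ continuous_subtype_val.continuousOn

theorem isClosed_of_mem_springerComponents (hK : K ∈ springerComponents u n) : IsClosed K := by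
  obtain ⟨C, hC, rfl⟩ := hK
  exact (isClosed_springerFiber u).isClosedEmbedding_subtypeVal.isClosedMap _
    (isClosed_of_mem_irreducibleComponents C hC)

theorem subset_springerFiber_of_mem_springerComponents (hK : K ∈ springerComponents u n) :
    K ⊆ springerFiber u n := by
  obtain ⟨C, -, rfl⟩ := hK
  exact Subtype.coe_image_subset _ _

/-- Maximality of a component, transferred from the subspace topology of the fiber to sets of flags.
-/
theorem subset_of_mem_springerComponents (hK : K ∈ springerComponents u n)
    {W : Set (CompleteFlag k V n)} (hW : IsIrreducible W) (hWu : W ⊆ springerFiber u n)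
    (hKW : K ⊆ W) : W ⊆ K := by
  obtain ⟨C, hC, rfl⟩ := hK
  have hWirr : IsIrreducible (Subtype.val ⁻¹' W : Set (springerFiber u n)) := by
    obtain ⟨F, hF⟩ := hW.1
    refine ⟨⟨⟨F, hWu hF⟩, hF⟩, ?_⟩
    rintro _ _ ⟨U₁, hU₁, rfl⟩ ⟨U₂, hU₂, rfl⟩ ⟨F₁, hF₁, h₁⟩ ⟨F₂, hF₂, h₂⟩
    obtain ⟨G, hG, hGU⟩ := hW.2 U₁ U₂ hU₁ hU₂ ⟨F₁, hF₁, h₁⟩ ⟨F₂, hF₂, h₂⟩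
    exact ⟨⟨G, hWu hG⟩, hG, hGU⟩
  have h2 := hC.2 hWirr fun F hF => hKW ⟨F, hF, rfl⟩
  intro F hF
  exact ⟨⟨F, hWu hF⟩, h2 hF, rfl⟩

theorem map_mem_springerFiber {g : V ≃ₗ[k] V} {c : k} (h : ∀ v, u (g v) = c • g (u v))
    {F : CompleteFlag k V n} (hF : F ∈ springerFiber u n) : F.map g ∈ springerFiber u n := by
  rintro i _ ⟨_, ⟨v, hv, rfl⟩, rfl⟩
  change u (g v) ∈ _
  rw [h]
  exact Submodule.smul_mem _ _ (CompleteFlag.mem_map (hF i (Submodule.mem_map_of_mem hv)))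

theorem infinite_units (k : Type*) [Field k] [Infinite k] : Infinite kˣ := by
  rw [unitsEquivNeZero.infinite_iff]
  exact (Set.finite_singleton (0 : k)).infinite_compl.to_subtype

/-- The components of the Springer fiber are stable under a one-parameter subgroup which normalizes
the line of `u`. -/
theorem map_torus_mem [Infinite k] (hK : K ∈ springerComponents u n) (e : Basis (Fin n) k V)
    (w : Fin n → ℕ) {c : kˣ → k} (h : ∀ t v, u (torus e w t v) = c t • torus e w t (u v))
    {F : CompleteFlag k V n} (hF : F ∈ K) (t : kˣ) : F.map (torus e w t) ∈ K := by
  have := infinite_units k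
  have hirr := isIrreducible_of_mem_springerComponents hK
  let W : Set (CompleteFlag k V n) := {G | ∃ F ∈ K, ∃ t, G = F.map (torus e w t)}
  have hKW : K ⊆ W := fun F hF => ⟨F, hF, 1, by rw [torus_one, CompleteFlag.map_refl]⟩
  have hWu : W ⊆ springerFiber u n := by
    rintro _ ⟨F, hF, t, rfl⟩
    exact map_mem_springerFiber (h t) (subset_springerFiber_of_mem_springerComponents hK hF)
  have hW : IsIrreducible W := by
    refine ⟨hirr.1.mono hKW, ?_⟩
    rintro U₁ U₂ hU₁ hU₂ ⟨_, ⟨F₁, hF₁, s₁, rfl⟩, h₁⟩ ⟨_, ⟨F₂, hF₂, s₂, rfl⟩, h₂⟩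
    obtain ⟨F, hF, hs₁, hs₂⟩ := hirr.2 _ _ (isOpen_preimage_map hU₁ (torus e w s₁))
      (isOpen_preimage_map hU₂ (torus e w s₂)) ⟨F₁, hF₁, h₁⟩ ⟨F₂, hF₂, h₂⟩
    -- The orbit of the single flag `F` meets both open sets, at `s₁` and `s₂`, so all but finitely
    -- many of its points lie in both.
    obtain ⟨t, ht⟩ := ((finite_setOf_orbit_notMem hU₁ e w F hs₁).union
      (finite_setOf_orbit_notMem hU₂ e w F hs₂)).exists_notMem
    simp only [Set.mem_union, Set.mem_ofPred_eq, not_or, not_not] at ht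
    exact ⟨_, ⟨F, hF, t, rfl⟩, ht⟩
  exact subset_of_mem_springerComponents hK hW hWu hKW ⟨F, hF, t, rfl⟩

end Components

/-! ### Jordan bases -/

section Jordan

variable {k V : Type*} [Field k] [AddCommGroup V] [Module k V] {Y : YoungDiagram}
  {u : V →ₗ[k] V} {e : Basis Y.cells k V}

/-- Weights of the boxes which distinguish them, and increase by one from left to right. -/
def boxWeight (Y : YoungDiagram) (x : Y.cells) : ℕ := Y.rowLen 0 * x.1.1 + x.1.2

theorem boxWeight_injective (Y : YoungDiagram) : Function.Injective (boxWeight Y) := by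
  have hlt : ∀ x : Y.cells, x.1.2 < Y.rowLen 0 := fun x =>
    YoungDiagram.mem_iff_lt_rowLen.1 (Y.up_left_mem (Nat.zero_le _) le_rfl x.2)
  intro x y h
  have hx := hlt x
  have hy := hlt y
  have hpos : 0 < Y.rowLen 0 := by omega
  unfold boxWeight at h
  have h1 : x.1.1 = y.1.1 := by
    have := congrArg (· / Y.rowLen 0) h
    simpa [Nat.mul_add_div hpos, Nat.div_eq_of_lt hx, Nat.div_eq_of_lt hy] using this
  have h2 : x.1.2 = y.1.2 := by
    rw [h1] at h
    exact Nat.add_left_cancel h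
  exact Subtype.ext (Prod.ext h1 h2)

/-- On the Jordan basis `u` either vanishes or moves one box to the left, which lowers the weight by
exactly one. -/
theorem IsJordanBasis.apply_torus (he : IsJordanBasis u e) (t : kˣ) (v : V) :
    u (torus e (boxWeight Y) t v) = (t : k) • torus e (boxWeight Y) t (u v) := by
  suffices h : u ∘ₗ (torus e (boxWeight Y) t : V →ₗ[k] V) =
      (t : k) • ((torus e (boxWeight Y) t : V →ₗ[k] V) ∘ₗ u) from LinearMap.congr_fun h v
  refine e.ext fun x => ?_
  obtain ⟨⟨i, j⟩, hx⟩ := x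
  change u (torus e _ t (e _)) = (t : k) • torus e _ t (u (e _))
  rw [torus_basis, map_smul]
  cases j with
  | zero => rw [he.1 i hx]; simp
  | succ j =>
    have hx' : (i, j) ∈ Y.cells := Y.up_left_mem le_rfl (Nat.le_succ j) hx
    rw [he.2 i j hx hx', torus_basis, smul_smul]
    congr 1
    simp only [boxWeight]
    ring

/-- A numbering of the boxes whose flag lies in the Springer fiber is row-standard. -/
theorem IsJordanBasis.exists_rowStandardTableau (he : IsJordanBasis u e) (σ : Y.cells ≃ Fin Y.card)
    (hσ : flagOfBasis (e.reindex σ) ∈ springerFiber u Y.card) :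
    ∃ T : RowStandardTableau Y, T.flag e = flagOfBasis (e.reindex σ) := by
  have hstep : ∀ i j (h : (i, j + 1) ∈ Y.cells) (h' : (i, j) ∈ Y.cells),
      σ ⟨(i, j), h'⟩ < σ ⟨(i, j + 1), h⟩ := by
    intro i j h h'
    have h1 : e ⟨(i, j + 1), h⟩ ∈ (flagOfBasis (e.reindex σ)).space (σ ⟨(i, j + 1), h⟩).succ := by
      have := (flagOfBasis_eq_iff (e.reindex σ) _).1 rfl (σ ⟨(i, j + 1), h⟩)
      simpa using this
    have h2 := hσ _ (Submodule.mem_map_of_mem h1)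
    rw [he.2 i j h h', mem_flagOfBasis_space_iff] at h2
    -- Otherwise `u` would send a vector of the space indexed by the right box to a basis vector
    -- that has not yet appeared there.
    by_contra! hle
    have hne : σ ⟨(i, j + 1), h⟩ ≠ σ ⟨(i, j), h'⟩ := by
      intro heq
      have := σ.injective heq
      simp at this
    have := h2 (σ ⟨(i, j), h'⟩) (Fin.succ_le_castSucc_iff.2 (lt_of_le_of_ne hle hne))
    simp at this
  have hrow : ∀ i d j (h : (i, j + d + 1) ∈ Y.cells) (h' : (i, j) ∈ Y.cells),
      σ ⟨(i, j), h'⟩ < σ ⟨(i, j + d + 1), h⟩ := by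
    intro i d
    induction d with
    | zero => exact fun j h h' => hstep i j h h'
    | succ d ih =>
      intro j h h'
      have h'' : (i, j + d + 1) ∈ Y.cells := Y.up_left_mem le_rfl (Nat.le_succ _) h
      exact (ih j h'' h').trans (hstep i (j + d + 1) h h'')
  refine ⟨⟨σ, ?_⟩, rfl⟩
  rintro ⟨⟨i, j⟩, hx⟩ ⟨⟨i', j'⟩, hy⟩ h hlt
  obtain rfl : i = i' := h
  obtain ⟨d, rfl⟩ := Nat.exists_eq_add_of_lt (show j < j' from hlt)
  exact hrow i d j hy hx

end Jordan

end SpringerFiber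

end

theorem lemma1p3 {k V : Type*} [Field k] [IsAlgClosed k] [AddCommGroup V] [Module k V]
    (Y : YoungDiagram) (u : V →ₗ[k] V) (e : Module.Basis Y.cells k V)
    (he : SpringerFiber.IsJordanBasis u e)
    (K : Set (SpringerFiber.CompleteFlag k V Y.card))
    (hK : K ∈ SpringerFiber.springerComponents u Y.card) :
    SpringerFiber.IsNonsingular K ↔
      ∀ T : SpringerFiber.RowStandardTableau Y,
        T.flag e ∈ K → SpringerFiber.IsNonsingularAt K (T.flag e) := by
  open SpringerFiber in
  refine ⟨fun h T hT => h _ hT, fun h F hF => ?_⟩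
  have : Module.Finite k V := Module.Finite.of_basis e
  have : Infinite k := IsAlgClosed.instInfinite
  have := infinite_units k
  have hirr := isIrreducible_of_mem_springerComponents hK
  have hcl := isClosed_of_mem_springerComponents hK
  let τ : Y.cells ≃ Fin Y.card := Y.cells.equivFin
  let E := e.reindex τ
  let w : Fin Y.card → ℕ := boxWeight Y ∘ τ.symm
  have hw : Function.Injective w := (boxWeight_injective Y).comp τ.symm.injective
  have htorus : ∀ t, torus E w t = torus e (boxWeight Y) t := fun t =>
    e.ext' fun x => by
      have h1 := torus_basis E w t (τ x)
      simp only [E, w, Module.Basis.reindex_apply, Equiv.symm_apply_apply, Function.comp_apply]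
        at h1
      rw [h1, torus_basis]
  have hstable : ∀ {G : CompleteFlag k V Y.card}, G ∈ K → ∀ t, G.map (torus E w t) ∈ K :=
    fun hG t => map_torus_mem hK E w (c := fun t => (t : k))
      (fun t v => by rw [htorus]; exact he.apply_torus t v) hG t
  obtain ⟨x, hx⟩ := exists_limit E hw F
  have hF₀ : flagOfBasis (E.reindex x) ∈ K := by
    by_contra hnot
    obtain ⟨t, ht⟩ := (hx _ hcl.isOpen_compl hnot).exists_notMem
    exact ht fun hc => hc (hstable hF t)
  have hreindex : E.reindex x = e.reindex (τ.trans x) := 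
    Module.Basis.eq_of_apply_eq fun i => by simp [E]
  rw [hreindex] at hx hF₀
  obtain ⟨T, hT⟩ := he.exists_rowStandardTableau (τ.trans x)
    (subset_springerFiber_of_mem_springerComponents hK hF₀)
  rw [← hT] at hx hF₀
  obtain ⟨-, β, a, ha, hdim⟩ := h T hF₀
  -- The nonvanishing locus of this minor is an open neighbourhood of the limit flag in the chart,
  -- so it contains a translate `chart β b` of `F`.
  obtain ⟨r, s, f, hf, hdet, hr⟩ := exists_jacobianMinor_ne_zero (chart β ⁻¹' K) a
  obtain ⟨t, ht⟩ := (hx _ (isOpen_chart_image β (jacobianMinor s f))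
    ⟨a, hdet, ha⟩).exists_notMem
  obtain ⟨b, hb, hbt⟩ := not_not.1 ht
  have hiff : ∀ G : CompleteFlag k V Y.card, G.map (torus E w t) ∈ K ↔ G ∈ K := by
    refine fun G => ⟨fun hG => ?_, fun hG => hstable hG t⟩
    have := hstable hG t⁻¹
    rwa [CompleteFlag.map_map, torus_trans, mul_inv_cancel, torus_one, CompleteFlag.map_refl]
      at this
  have hbK : chart β b ∈ K := hbt ▸ hstable hF t
  refine IsNonsingularAt.of_map hiff ⟨hstable hF t, β, b, hbt, ?_⟩
  -- One inequality holds at every point of `K`. The other is semicontinuity: the same minor is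
  -- nonzero at `b`, so the tangent space there is no larger than at `a`.
  refine le_antisymm ?_ (topologicalKrullDim_le_finrank hirr hcl hbK)
  rw [← hdim]
  have := finrank_affineTangentSpace_add_le hf hb
  exact_mod_cast (by omega : Module.finrank k (affineTangentSpace (chart β ⁻¹' K) b) ≤
    Module.finrank k (affineTangentSpace (chart β ⁻¹' K) a))
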